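/- Let $q\in[1,\infty]$ and let $p\in[1,\infty]$ satisfy $1/p+1/q=1$. On $\mathbb R^d\times\mathbb R$ let $N_q((x,y),(u,v))=\|x-u\|_q$ if $y=v$ and $N_q((x,y),(u,v))=\infty$ otherwise, and put $c=N_q^2$. For probability measures $P,Q$ on $\mathbb R^d\times\mathbb R$ let $D_c(P,Q)=\inf\{E_\pi[c(U,W)]\}$, the infimum being over all joint laws $\pi$ of $(U,W)$ with $U\sim P$ and $W\sim Q$. Let $\beta_*\in\mathbb R^d$ and let $(X_1,e_1),(X_2,e_2),\dots$ be i.i.d. copies of $(X,e)$, where $X$ is a random vector in $\mathbb R^d$ with $E\|X\|_2^2<\infty$ and $e$ is a real random variable, independent of $X$, with $E[e]=0$ and $\mathrm{Var}(e)=\sigma^2<\infty$, $\sigma\ge 0$. Put $Y_i=\beta_*^TX_i+e_i$, let $P_n=\frac1n\sum_{i=1}^n\delta_{(X_i,Y_i)}$ be the empirical distribution, and let $$R_n(\beta)=\inf\big\{D_c(P,P_n):\ E_P[(Y-\beta^TX)X]=\mathbf 0\big\},$$ where $P$ ranges over the probability measures on $\mathbb R^d\times\mathbb R$ for which this expectation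 exists. Let $\Sigma=E[XX^T]$ (this is $\mathrm{Cov}[X]$ when $X$ is centered) and let $Z\sim\mathcal N(\mathbf 0,\Sigma)$. Then $R_n(\beta_*)<\infty$ for all $n\ge 1$, and, as $n\to\infty$, $nR_n(\beta_*)$ converges in distribution to $$L_1:=\max_{\xi\in\mathbb R^d}\Big\{2\sigma\,\xi^TZ-E\big\|e\,\xi-(\xi^TX)\beta_*\big\|_p^2\Big\},$$ where the expectation is over $(X,e)$ only and the maximum is attained for every value of $Z$. Further, if $(E|e|)^2<E[e^2]$, that is, if $|e|$ is not almost surely constant, then $L_1$ is stochastically dominated by $$L_2:=\frac{E[e^2]}{E[e^2]-(E|e|)^2}\,\|Z\|_q^2,$$ that is, $P(L_1>t)\le P(L_2>t)$ for all $t\in\mathbb R$. If $e$ is centered normal, then $L_1$ is stochastically dominated by $\frac{\pi}{\pi-2}\|Z\|_q^2$. -/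

import Mathlib

open MeasureTheory ProbabilityTheory Filter Topology
open scoped ENNReal NNReal

noncomputable section

namespace RWP

/-- The `ℓ_p` norm of a vector of `ℝ^d`, for `p ∈ [1, ∞]`. -/
def vecNorm {d : ℕ} (p : ℝ≥0∞) (x : EuclideanSpace ℝ (Fin d)) : ℝ :=
  ‖WithLp.toLp p (fun i : Fin d => x i)‖

/-- The extended-valued metric `N_q((x, y), (u, v))`: it is `‖x - u‖_q` if `y = v`, and `∞`
otherwise. -/
def modNorm {d : ℕ} (q : ℝ≥0∞) (a b : EuclideanSpace ℝ (Fin d) × ℝ) : ℝ≥0∞ :=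
  open Classical in if a.2 = b.2 then ENNReal.ofReal (vecNorm q (a.1 - b.1)) else ⊤

/-- The optimal transport cost `D_c(P, Q)`: the infimum of `E_π[c(U, W)]` over all the couplings
`π` of `P` (the law of `U`) and `Q` (the law of `W`). -/
def transportCost {S : Type*} [MeasurableSpace S] (c : S → S → ℝ≥0∞) (P Q : Measure S) : ℝ≥0∞ :=
  ⨅ (π : Measure (S × S)) (_ : IsProbabilityMeasure π) (_ : π.map Prod.fst = P)
    (_ : π.map Prod.snd = Q), ∫⁻ a, c a.1 a.2 ∂π

/-- The empirical distribution `n⁻¹ ∑_{i < n} δ_{w i}` of the first `n` terms of a sequence. -/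
def empirical {S : Type*} [MeasurableSpace S] (n : ℕ) (w : ℕ → S) : Measure S :=
  (n : ℝ≥0∞)⁻¹ • ∑ i ∈ Finset.range n, Measure.dirac (w i)

/-- The estimating equation `E_P[(Y - βᵀX) X] = 0`; the expectation is required to exist. -/
def SolvesEstimatingEq {d : ℕ} (β : EuclideanSpace ℝ (Fin d))
    (P : Measure (EuclideanSpace ℝ (Fin d) × ℝ)) : Prop :=
  Integrable (fun w : EuclideanSpace ℝ (Fin d) × ℝ => (w.2 - inner ℝ β w.1) • w.1) P ∧
    ∫ w, (w.2 - inner ℝ β w.1) • w.1 ∂P = 0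

/-- The robust Wasserstein profile function
`R_n(β) = inf {D_c(P, P_n) : E_P[(Y - βᵀX) X] = 0}` with cost `c = N_q²`, where `P` ranges over the
probability measures and `P_n` is the empirical distribution of the data `w 0, …, w (n - 1)`. -/
def profile {d : ℕ} (q : ℝ≥0∞) (n : ℕ) (w : ℕ → EuclideanSpace ℝ (Fin d) × ℝ)
    (β : EuclideanSpace ℝ (Fin d)) : ℝ≥0∞ :=
  ⨅ (P : Measure (EuclideanSpace ℝ (Fin d) × ℝ)) (_ : IsProbabilityMeasure P)
    (_ : SolvesEstimatingEq β P),
    transportCost (fun a b => modNorm q a b ^ 2) P (empirical n w)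

/-- The matrix `E[X Xᵀ]`. -/
def secondMoment {d : ℕ} {Ω : Type*} [MeasurableSpace Ω] (μ : Measure Ω)
    (X : Ω → EuclideanSpace ℝ (Fin d)) : Matrix (Fin d) (Fin d) ℝ :=
  Matrix.of fun i j => ∫ ω, X ω i * X ω j ∂μ

/-- The concave function `ξ ↦ 2 σ ξᵀz - E‖e ξ - (ξᵀX) β‖_p²`. -/
def limitObjective {d : ℕ} {Ω : Type*} [MeasurableSpace Ω] (μ : Measure Ω) (p : ℝ≥0∞)
    (X : Ω → EuclideanSpace ℝ (Fin d)) (e : Ω → ℝ) (β : EuclideanSpace ℝ (Fin d)) (σ : ℝ)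
    (z ξ : EuclideanSpace ℝ (Fin d)) : ℝ :=
  2 * σ * inner ℝ ξ z - ∫ ω, vecNorm p (e ω • ξ - inner ℝ ξ (X ω) • β) ^ 2 ∂μ

/-- The value `sup_ξ {2 σ ξᵀz - E‖e ξ - (ξᵀX) β‖_p²}`, as a function of `z`. -/
def limitValue {d : ℕ} {Ω : Type*} [MeasurableSpace Ω] (μ : Measure Ω) (p : ℝ≥0∞)
    (X : Ω → EuclideanSpace ℝ (Fin d)) (e : Ω → ℝ) (β : EuclideanSpace ℝ (Fin d)) (σ : ℝ)
    (z : EuclideanSpace ℝ (Fin d)) : ℝ :=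
  ⨆ ξ : EuclideanSpace ℝ (Fin d), limitObjective μ p X e β σ z ξ

/-- The real random variable `A` is stochastically dominated by `B`:
`P(A > t) ≤ P(B > t)` for every real `t`. -/
def StochDominated {Ω₁ Ω₂ : Type*} [MeasurableSpace Ω₁] [MeasurableSpace Ω₂]
    (A : Ω₁ → ℝ) (μ₁ : Measure Ω₁) (B : Ω₂ → ℝ) (μ₂ : Measure Ω₂) : Prop :=
  ∀ t : ℝ, μ₁ {ω | t < A ω} ≤ μ₂ {ω | t < B ω}

end RWP

end

/-! The proof is Lagrangian duality followed by a local expansion of the dual. A coupling with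
finite cost leaves the responses fixed, so the only freedom is to move the covariates. By weak
duality a multiplier `l` bounds `R_n` below by the mean over the data of the infima over `u` of `‖u
- x_i‖_q² - lᵀ(y_i - βᵀu)u`; conversely every `c` in `[0, R_n)` is certified by some `l`
(`exists_le_lagrangian`), by separating `(0, c)` from the convex set of attainable pairs (mean of
the estimating function, cost).

With `l = -2ξ/√n` and `u = x_i + v` the Lagrangian is quadratic in `v` up to the term `(βᵀv)(lᵀv)`,
which is at most `O(n^{-1/2}) ‖v‖_q²` for bounded `ξ`. Hölder's inequality and its equality case
then identify the dual value with `2 ξᵀH_n - n⁻¹ ∑ ‖e_i ξ - (ξᵀX_i) β‖_p²`, where `H_n = n^{-1/2} ∑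
e_i X_i`, up to a factor `1 + O(n^{-1/2})` on the quadratic term (`le_mul_profile`,
`mul_profile_le`).

The population quadratic term is coercive when `σ > 0`, since independence and `E e = 0` kill the
cross term. Coercivity, with concavity of the dual in `l`, confines `ξ` to a fixed ball, where a
uniform law of large numbers applies. Thus `n R_n` differs from a continuous function of `H_n` by a
term vanishing in probability, and the central limit theorem `H_n → σZ` concludes. If `σ = 0`, then
almost surely the data solve the equation and all quantities vanish.

The stochastic bounds hold pointwise in `Z`: the reverse triangle inequality and independence give
`‖ξ‖_p² (E e² - (E|e|)²)` as a lower bound of the quadratic term, and Hölder's inequality with a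
completed square does the rest. -/

noncomputable section

namespace RWP

variable {d : ℕ} {p q : ℝ≥0∞}

/-! ### Norms on `ℝ^d` and Hölder duality. -/

/-- The linear equivalence between the Euclidean space and `ℝ^d` with the `ℓ_p` norm. -/
def toPiLp (d : ℕ) (p : ℝ≥0∞) [Fact (1 ≤ p)] :
    EuclideanSpace ℝ (Fin d) ≃L[ℝ] PiLp p (fun _ : Fin d => ℝ) :=
  ((WithLp.linearEquiv 2 ℝ (Fin d → ℝ)).trans
    (WithLp.linearEquiv p ℝ (Fin d → ℝ)).symm).toContinuousLinearEquiv

lemma vecNorm_eq [Fact (1 ≤ p)] (x : EuclideanSpace ℝ (Fin d)) : vecNorm p x = ‖toPiLp d p x‖ :=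
  rfl

lemma vecNorm_nonneg [Fact (1 ≤ p)] (x : EuclideanSpace ℝ (Fin d)) : 0 ≤ vecNorm p x :=
  norm_nonneg (toPiLp d p x)

@[simp] lemma vecNorm_zero [Fact (1 ≤ p)] : vecNorm p (0 : EuclideanSpace ℝ (Fin d)) = 0 := by
  simp [vecNorm_eq]

lemma vecNorm_smul [Fact (1 ≤ p)] (c : ℝ) (x : EuclideanSpace ℝ (Fin d)) :
    vecNorm p (c • x) = |c| * vecNorm p x := by
  simp [vecNorm_eq, norm_smul]

lemma vecNorm_add_le [Fact (1 ≤ p)] (x y : EuclideanSpace ℝ (Fin d)) :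
    vecNorm p (x + y) ≤ vecNorm p x + vecNorm p y := by
  simpa [vecNorm_eq] using norm_add_le (toPiLp d p x) (toPiLp d p y)

lemma abs_vecNorm_sub_le [Fact (1 ≤ p)] (x y : EuclideanSpace ℝ (Fin d)) :
    |vecNorm p x - vecNorm p y| ≤ vecNorm p (x - y) := by
  simpa [vecNorm_eq] using abs_norm_sub_norm_le (toPiLp d p x) (toPiLp d p y)

@[fun_prop] lemma continuous_vecNorm [Fact (1 ≤ p)] :
    Continuous (vecNorm p : EuclideanSpace ℝ (Fin d) → ℝ) :=
  (toPiLp d p).continuous.norm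

lemma exists_vecNorm_le (d : ℕ) (p : ℝ≥0∞) [Fact (1 ≤ p)] :
    ∃ C : ℝ, 0 < C ∧ ∀ x : EuclideanSpace ℝ (Fin d), vecNorm p x ≤ C * ‖x‖ := by
  refine ⟨‖(toPiLp d p).toContinuousLinearMap‖ + 1, by positivity, fun x => ?_⟩
  rw [vecNorm_eq]
  refine ((toPiLp d p).toContinuousLinearMap.le_opNorm x).trans ?_
  gcongr
  linarith

lemma exists_norm_le_vecNorm (d : ℕ) (p : ℝ≥0∞) [Fact (1 ≤ p)] :
    ∃ C : ℝ, 0 < C ∧ ∀ x : EuclideanSpace ℝ (Fin d), ‖x‖ ≤ C * vecNorm p x := by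
  refine ⟨‖(toPiLp d p).symm.toContinuousLinearMap‖ + 1, by positivity, fun x => ?_⟩
  rw [vecNorm_eq]
  have h := (toPiLp d p).symm.toContinuousLinearMap.le_opNorm (toPiLp d p x)
  simp only [ContinuousLinearEquiv.coe_coe, ContinuousLinearEquiv.symm_apply_apply] at h
  refine h.trans ?_
  gcongr
  linarith

lemma fact_one_le_of_holderConjugate (hpq : ENNReal.HolderConjugate p q) : Fact (1 ≤ p) :=
  ⟨ENNReal.HolderConjugate.one_le p q⟩

lemma inner_eq_sum (x y : EuclideanSpace ℝ (Fin d)) : inner ℝ x y = ∑ i, x i * y i := by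
  simp [PiLp.inner_apply, mul_comm]

lemma vecNorm_one (x : EuclideanSpace ℝ (Fin d)) : vecNorm 1 x = ∑ i, |x i| := by
  simp [vecNorm, PiLp.norm_eq_of_L1]

lemma vecNorm_top_le {x : EuclideanSpace ℝ (Fin d)} {a : ℝ} (ha : 0 ≤ a) (h : ∀ i, |x i| ≤ a) :
    vecNorm ∞ x ≤ a := by
  simp only [vecNorm, PiLp.norm_eq_ciSup]
  exact Real.iSup_le h ha

lemma abs_apply_le_vecNorm_top (x : EuclideanSpace ℝ (Fin d)) (i : Fin d) :
    |x i| ≤ vecNorm ∞ x := by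
  simp only [vecNorm, PiLp.norm_eq_ciSup]
  exact le_ciSup (f := fun i => |x i|) (Set.finite_range _).bddAbove i

lemma vecNorm_eq_coe (hp : 0 < p.toReal) (x : EuclideanSpace ℝ (Fin d)) :
    vecNorm p x = ((∑ i, ‖x i‖₊ ^ p.toReal) ^ (1 / p.toReal) : ℝ≥0) := by
  simp [vecNorm, PiLp.norm_eq_sum hp]

/-- Equality case of Hölder's inequality. For finite exponents a nonnegative extremal vector for
`|v|` is given the signs of `v`; for `p = ∞` a signed unit vector at a largest coordinate works, and
for `p = 1` the sign vector. -/
lemma exists_dual_unit (hpq : ENNReal.HolderConjugate p q) (v : EuclideanSpace ℝ (Fin d)) :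
    ∃ y : EuclideanSpace ℝ (Fin d), vecNorm q y ≤ 1 ∧ inner ℝ y v = vecNorm p v := by
  by_cases hp : p = ∞
  · subst hp
    have hq : q = 1 := ENNReal.HolderTriple.unique_of_ne_zero (p := ∞) (r := 1) q 1 (by simp)
    subst hq
    rcases Nat.eq_zero_or_pos d with rfl | hd
    · refine ⟨0, by simp, ?_⟩
      simp [vecNorm, PiLp.norm_eq_ciSup]
    · have : Nonempty (Fin d) := ⟨⟨0, hd⟩⟩
      obtain ⟨j, hj⟩ := exists_eq_ciSup_of_finite (f := fun i => |v i|)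
      refine ⟨EuclideanSpace.single j ((SignType.sign (v j) : SignType) : ℝ), ?_, ?_⟩
      · rw [vecNorm_one, Finset.sum_eq_single j]
        · rcases lt_trichotomy (v j) 0 with h | h | h <;> simp [h]
        · intro i _ hi; simp [hi]
        · simp
      · rw [inner_eq_sum, Finset.sum_eq_single j]
        · simp only [PiLp.single_apply, if_true, sign_mul_self]
          simpa [vecNorm, PiLp.norm_eq_ciSup] using hj
        · intro i _ hi; simp [hi]
        · simp
  by_cases hq : q = ∞
  · subst hq
    have hp1 : p = 1 :=
      ENNReal.HolderTriple.unique_of_ne_zero (p := ∞) (r := 1) p 1 (by simp)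
    subst hp1
    refine ⟨WithLp.toLp 2 fun i => ((SignType.sign (v i) : SignType) : ℝ),
      vecNorm_top_le zero_le_one fun i => ?_, ?_⟩
    · rcases lt_trichotomy (v i) 0 with h | h | h <;> simp [h]
    · simp [inner_eq_sum, vecNorm_one]
  have hr := ENNReal.HolderConjugate.toReal_of_ne_top hp hq
  obtain ⟨g, hg, hgv⟩ := (NNReal.isGreatest_Lp Finset.univ (fun i => ‖v i‖₊) hr).1
  refine ⟨WithLp.toLp 2 fun i => ((SignType.sign (v i) : SignType) : ℝ) * g i, ?_, ?_⟩
  · rw [vecNorm_eq_coe hr.symm.pos]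
    norm_cast
    refine NNReal.rpow_le_one (le_trans (Finset.sum_le_sum fun i _ => ?_) hg)
      (by have := hr.symm.pos; positivity)
    refine NNReal.rpow_le_rpow ?_ hr.symm.nonneg
    rcases lt_trichotomy (v i) 0 with h | h | h <;> simp [h]
  · rw [vecNorm_eq_coe hr.pos, ← hgv, inner_eq_sum]
    push_cast
    refine Finset.sum_congr rfl fun i _ => ?_
    simp only [Real.norm_eq_abs]
    rw [← sign_mul_self]
    ring

lemma inner_le_vecNorm_mul (hpq : ENNReal.HolderConjugate p q) (x y : EuclideanSpace ℝ (Fin d)) :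
    inner ℝ x y ≤ vecNorm p x * vecNorm q y := by
  by_cases hp : p = ∞
  · subst hp
    have hq : q = 1 := ENNReal.HolderTriple.unique_of_ne_zero (p := ∞) (r := 1) q 1 (by simp)
    subst hq
    rw [inner_eq_sum, vecNorm_one, Finset.mul_sum]
    refine Finset.sum_le_sum fun i _ => (le_abs_self _).trans ?_
    rw [abs_mul]
    gcongr
    exact abs_apply_le_vecNorm_top x i
  by_cases hq : q = ∞
  · subst hq
    have hp1 : p = 1 :=
      ENNReal.HolderTriple.unique_of_ne_zero (p := ∞) (r := 1) p 1 (by simp)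
    subst hp1
    rw [inner_eq_sum, vecNorm_one, Finset.sum_mul]
    refine Finset.sum_le_sum fun i _ => (le_abs_self _).trans ?_
    rw [abs_mul]
    gcongr
    exact abs_apply_le_vecNorm_top y i
  have hr := ENNReal.HolderConjugate.toReal_of_ne_top hp hq
  rw [inner_eq_sum, vecNorm_eq_coe hr.pos, vecNorm_eq_coe hr.symm.pos]
  have h := Real.inner_le_Lp_mul_Lq Finset.univ (fun i => x i) (fun i => y i) hr
  simpa using h

lemma abs_inner_le_vecNorm_mul (hpq : ENNReal.HolderConjugate p q)
    (x y : EuclideanSpace ℝ (Fin d)) : |inner ℝ x y| ≤ vecNorm p x * vecNorm q y := by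
  have := fact_one_le_of_holderConjugate hpq
  refine abs_le.2 ⟨?_, inner_le_vecNorm_mul hpq x y⟩
  have h := inner_le_vecNorm_mul hpq ((-1 : ℝ) • x) y
  rw [vecNorm_smul, real_inner_smul_left] at h
  simp at h
  linarith

/-- A vector `y` with `‖y‖_q ≤ ‖v‖_p` and `yᵀv = ‖v‖_p²`. -/
lemma exists_dual_vector (hpq : ENNReal.HolderConjugate p q) (v : EuclideanSpace ℝ (Fin d)) :
    ∃ y : EuclideanSpace ℝ (Fin d), vecNorm q y ≤ vecNorm p v ∧
      inner ℝ y v = vecNorm p v ^ 2 := by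
  have := fact_one_le_of_holderConjugate hpq
  have : Fact (1 ≤ q) := fact_one_le_of_holderConjugate (q := p) hpq.symm
  obtain ⟨y, hy, hyv⟩ := exists_dual_unit hpq v
  refine ⟨vecNorm p v • y, ?_, ?_⟩
  · rw [vecNorm_smul, abs_of_nonneg (vecNorm_nonneg v)]
    exact mul_le_of_le_one_right (vecNorm_nonneg v) hy
  · rw [real_inner_smul_left, hyv, sq]

/-! ### Separation of a point from a convex set in finite dimension. -/

section Separation

variable {V : Type*} [NormedAddCommGroup V] [NormedSpace ℝ V] [FiniteDimensional ℝ V]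

/-- No closedness is needed: a convex set with empty interior spans a proper affine subspace, so
some nonzero functional is constant on it, and its sign can be chosen to suit `x`. -/
lemma exists_dual_ne_zero_le_of_convex {K : Set V} (hK : Convex ℝ K) (hne : K.Nonempty) {x : V}
    (hx : x ∉ K) : ∃ f : StrongDual ℝ V, f ≠ 0 ∧ ∀ y ∈ K, f x ≤ f y := by
  by_cases hint : (interior K).Nonempty
  · obtain ⟨f, hf, h⟩ := geometric_hahn_banach_of_nonempty_interior_point hK
      (fun h => hx (interior_subset h)) hint
    refine ⟨-f, neg_ne_zero.2 hf, fun y hy => ?_⟩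
    simpa using h y hy
  · have hspan : affineSpan ℝ K ≠ ⊤ := fun h =>
      hint (hK.interior_nonempty_iff_affineSpan_eq_top.2 h)
    obtain ⟨k, hk⟩ := hne
    have hdir : (affineSpan ℝ K).direction < ⊤ := by
      refine lt_top_iff_ne_top.2 fun h => hspan ?_
      exact (AffineSubspace.direction_eq_top_iff_of_nonempty
        ⟨k, subset_affineSpan ℝ K hk⟩).1 h
    obtain ⟨g, hg, hgle⟩ := Submodule.exists_le_ker_of_lt_top _ hdir
    have hconst : ∀ y ∈ K, g y = g k := by
      intro y hy
      have h := hgle (AffineSubspace.vsub_mem_direction (subset_affineSpan ℝ K hy)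
        (subset_affineSpan ℝ K hk))
      simpa [sub_eq_zero] using h
    have hg' : LinearMap.toContinuousLinearMap g ≠ 0 := by
      simpa using hg
    rcases le_total (g x) (g k) with h | h
    · exact ⟨LinearMap.toContinuousLinearMap g, hg', fun y hy => by simpa [hconst y hy] using h⟩
    · exact ⟨-LinearMap.toContinuousLinearMap g, neg_ne_zero.2 hg',
        fun y hy => by simpa [hconst y hy] using h⟩

end Separation

/-! ### Integration against the empirical distribution. -/

section Empirical

variable {S T : Type*} [MeasurableSpace S] [MeasurableSpace T]

lemma isProbabilityMeasure_empirical {n : ℕ} (hn : 1 ≤ n) (w : ℕ → S) :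
    IsProbabilityMeasure (empirical n w) := by
  constructor
  have hn' : (n : ℝ≥0∞) ≠ 0 := by exact_mod_cast (by omega : n ≠ 0)
  simp [empirical, ENNReal.inv_mul_cancel hn' (ENNReal.natCast_ne_top n)]

lemma empirical_map (n : ℕ) (w : ℕ → S) {f : S → T} (hf : Measurable f) :
    (empirical n w).map f = empirical n (fun i => f (w i)) := by
  simp only [empirical, Measure.map_smul]
  congr 1
  rw [← Measure.mapₗ_apply_of_measurable hf, map_sum]
  exact Finset.sum_congr rfl fun i _ => by
    rw [Measure.mapₗ_apply_of_measurable hf, Measure.map_dirac' hf]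

lemma lintegral_empirical [MeasurableSingletonClass S] (n : ℕ) (w : ℕ → S) (f : S → ℝ≥0∞) :
    ∫⁻ a, f a ∂(empirical n w) = (n : ℝ≥0∞)⁻¹ * ∑ i ∈ Finset.range n, f (w i) := by
  simp [empirical, lintegral_finsetSum_measure]

variable {F : Type*} [NormedAddCommGroup F]

lemma integrable_empirical [MeasurableSingletonClass S] {n : ℕ} (hn : 1 ≤ n) (w : ℕ → S)
    (f : S → F) : Integrable f (empirical n w) := by
  refine Integrable.smul_measure ?_ (by simpa using by omega)
  exact integrable_finsetSum_measure.2 fun i _ => integrable_dirac (by simp)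

lemma integral_empirical [MeasurableSingletonClass S] [NormedSpace ℝ F] [CompleteSpace F]
    (n : ℕ) (w : ℕ → S) (f : S → F) :
    ∫ a, f a ∂(empirical n w) = (n : ℝ)⁻¹ • ∑ i ∈ Finset.range n, f (w i) := by
  rw [empirical, integral_smul_measure, integral_finsetSum_measure]
  · simp
  · exact fun i _ => integrable_dirac (by simp)

end Empirical

/-! ### Lagrangian duality for the profile function. -/

/-- The estimating function `(u, y) ↦ (y - βᵀu) u`. -/
def estFun (β : EuclideanSpace ℝ (Fin d)) (a : EuclideanSpace ℝ (Fin d) × ℝ) :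
    EuclideanSpace ℝ (Fin d) :=
  (a.2 - inner ℝ β a.1) • a.1

/-- The Lagrangian of the transport problem at one data point. -/
def lagrangian (q : ℝ≥0∞) (β l : EuclideanSpace ℝ (Fin d)) (w : EuclideanSpace ℝ (Fin d) × ℝ)
    (u : EuclideanSpace ℝ (Fin d)) : ℝ :=
  vecNorm q (u - w.1) ^ 2 - inner ℝ l (estFun β (u, w.2))

@[fun_prop] lemma continuous_estFun (β : EuclideanSpace ℝ (Fin d)) :
    Continuous (estFun β) := by
  unfold estFun; fun_prop

lemma estFun_zero (β : EuclideanSpace ℝ (Fin d)) (y : ℝ) : estFun β (0, y) = 0 := by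
  simp [estFun]

lemma measurable_modNorm [Fact (1 ≤ q)] :
    Measurable fun a : (EuclideanSpace ℝ (Fin d) × ℝ) × (EuclideanSpace ℝ (Fin d) × ℝ) =>
      modNorm q a.1 a.2 := by
  unfold modNorm
  refine Measurable.ite (measurableSet_eq_fun (by fun_prop) (by fun_prop)) ?_ measurable_const
  refine ENNReal.measurable_ofReal.comp ?_
  exact ((continuous_vecNorm.comp (by fun_prop : Continuous fun a :
    (EuclideanSpace ℝ (Fin d) × ℝ) × (EuclideanSpace ℝ (Fin d) × ℝ) => a.1.1 - a.2.1))).measurable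

lemma modNorm_of_eq {a b : EuclideanSpace ℝ (Fin d) × ℝ} (h : a.2 = b.2) :
    modNorm q a b = ENNReal.ofReal (vecNorm q (a.1 - b.1)) := by
  simp [modNorm, h]

lemma modNorm_sq_of_eq [Fact (1 ≤ q)] {a b : EuclideanSpace ℝ (Fin d) × ℝ} (h : a.2 = b.2) :
    modNorm q a b ^ 2 = ENNReal.ofReal (vecNorm q (a.1 - b.1) ^ 2) := by
  rw [modNorm_of_eq h, ENNReal.ofReal_pow (vecNorm_nonneg _)]

/-- Weak duality. -/
lemma le_profile_of_le_lagrangian [Fact (1 ≤ q)] {n : ℕ} (hn : 1 ≤ n)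
    {w : ℕ → EuclideanSpace ℝ (Fin d) × ℝ} {β l : EuclideanSpace ℝ (Fin d)} {c : ℝ}
    (h : ∀ u : ℕ → EuclideanSpace ℝ (Fin d),
      n * c ≤ ∑ i ∈ Finset.range n, lagrangian q β l (w i) (u i)) :
    ENNReal.ofReal c ≤ profile q n w β := by
  have hn0 : (0 : ℝ) < n := by exact_mod_cast hn
  set m : EuclideanSpace ℝ (Fin d) × ℝ → ℝ := fun a => ⨅ u, lagrangian q β l a u with hm
  have hbdd : ∀ i ∈ Finset.range n, BddBelow (Set.range fun u => lagrangian q β l (w i) u) := by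
    intro i hi
    -- Freeing one data point while parking the others at the origin shows that each summand is
    -- bounded below.
    refine ⟨n * c - ∑ j ∈ (Finset.range n).erase i, lagrangian q β l (w j) 0, ?_⟩
    rintro _ ⟨u, rfl⟩
    have h1 := h (Function.update 0 i u)
    rw [← Finset.add_sum_erase _ _ hi, Function.update_self,
      Finset.sum_congr rfl (g := fun j => lagrangian q β l (w j) 0)] at h1
    · simp only; linarith
    · intro j hj
      rw [Function.update_of_ne (Finset.ne_of_mem_erase hj)]; rfl
  have hsum : n * c ≤ ∑ i ∈ Finset.range n, m (w i) := by
    -- Sum and infima are exchanged by taking an `ε / n`-minimizer at each data point.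
    refine le_of_forall_pos_le_add fun ε hε => ?_
    have : ∀ i, ∃ u, i ∈ Finset.range n → lagrangian q β l (w i) u < m (w i) + ε / n := by
      intro i
      obtain ⟨u, hu⟩ := exists_lt_of_ciInf_lt (f := fun u => lagrangian q β l (w i) u)
        (a := m (w i) + ε / n) (by simp only [hm]; linarith [div_pos hε hn0])
      exact ⟨u, fun _ => hu⟩
    choose u hu using this
    calc n * c ≤ _ := h u
      _ ≤ ∑ i ∈ Finset.range n, (m (w i) + ε / n) :=
        Finset.sum_le_sum fun i hi => (hu i hi).le
      _ = _ := by rw [Finset.sum_add_distrib]; simp; field_simp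
  unfold profile transportCost
  refine le_iInf fun P => le_iInf fun hP => le_iInf fun hS => le_iInf fun π => le_iInf fun hπ =>
    le_iInf fun h1 => le_iInf fun h2 => ?_
  by_cases htop : ∫⁻ a, modNorm q a.1 a.2 ^ 2 ∂π = ⊤
  · simp [htop]
  have hmeas : Measurable fun a : (EuclideanSpace ℝ (Fin d) × ℝ) × (EuclideanSpace ℝ (Fin d) × ℝ) =>
      modNorm q a.1 a.2 ^ 2 := measurable_modNorm.pow_const 2
  have hfin := ae_lt_top hmeas htop
  have hint1 := integrable_toReal_of_lintegral_ne_top hmeas.aemeasurable htop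
  have hint2 : Integrable (fun a => estFun β (Prod.fst a)) π := by
    have := hS.1
    rw [← h1] at this
    exact (integrable_map_measure (continuous_estFun β).measurable.aestronglyMeasurable
      measurable_fst.aemeasurable).1 this
  have hint2' : ∫ a, estFun β (Prod.fst a) ∂π = 0 := by
    have := hS.2
    rw [← h1] at this
    exact (integral_map measurable_fst.aemeasurable
      (continuous_estFun β).measurable.aestronglyMeasurable).symm.trans this
  have hmI : Integrable m (π.map Prod.snd) := h2 ▸ integrable_empirical hn w m
  -- The infimum `m` is known to be a genuine lower bound only at data points, so the coupling's
  -- second coordinate must be located there.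
  have hmem : ∀ᵐ a ∂π, Prod.snd a ∈ (w '' (Finset.range n : Set ℕ)) := by
    have hms : MeasurableSet (w '' (Finset.range n : Set ℕ)) :=
      ((Finset.finite_toSet _).image w).measurableSet
    refine ae_of_ae_map measurable_snd.aemeasurable (p := fun b => b ∈ w '' _) ?_
    rw [h2, empirical]
    refine Measure.ae_smul_measure ?_ _
    simp only [ae_iff, Measure.coe_finsetSum, Finset.sum_apply, Finset.sum_eq_zero_iff]
    intro i hi
    refine (Measure.dirac_apply' _ hms.compl).trans ?_
    simp only [Set.indicator_apply_eq_zero]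
    intro hi'
    exact absurd ⟨i, by simpa using hi, rfl⟩ hi'
  have hle : ∫ a, m (Prod.snd a) ∂π ≤
      ∫ a, ((modNorm q a.1 a.2 ^ 2).toReal - inner ℝ l (estFun β (Prod.fst a))) ∂π := by
    refine integral_mono_ae (hmI.comp_measurable measurable_snd)
      (hint1.sub (hint2.const_inner l)) ?_
    filter_upwards [hfin, hmem] with a ha1 ha2
    obtain ⟨i, hi, hia⟩ := ha2
    have heq : a.1.2 = a.2.2 := by
      by_contra hne
      simp [modNorm, hne] at ha1
    have h3 : m a.2 ≤ lagrangian q β l a.2 a.1.1 := by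
      simp only [hm]
      rw [← hia]
      exact ciInf_le (hbdd i (by simpa using hi)) _
    refine h3.trans (le_of_eq ?_)
    rw [modNorm_sq_of_eq heq, ENNReal.toReal_ofReal (by positivity), lagrangian, ← heq]
  rw [integral_sub hint1 (hint2.const_inner l), integral_inner hint2, hint2', inner_zero_right,
    sub_zero, integral_toReal hmeas.aemeasurable hfin,
    ← integral_map measurable_snd.aemeasurable hmI.1, h2, integral_empirical] at hle
  refine (ENNReal.ofReal_le_iff_le_toReal htop).2 (le_trans ?_ hle)
  rw [smul_eq_mul, inv_mul_eq_div, le_div_iff₀ hn0]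
  linarith

/-- The pairs (mean of the estimating function, bound on the cost) of the couplings whose second
marginal is the empirical distribution. -/
def attainable (q : ℝ≥0∞) (n : ℕ) (w : ℕ → EuclideanSpace ℝ (Fin d) × ℝ)
    (β : EuclideanSpace ℝ (Fin d)) : Set (EuclideanSpace ℝ (Fin d) × ℝ) :=
  {z | ∃ π : Measure ((EuclideanSpace ℝ (Fin d) × ℝ) × (EuclideanSpace ℝ (Fin d) × ℝ)),
    IsProbabilityMeasure π ∧ π.map Prod.snd = empirical n w ∧
    Integrable (fun a => estFun β (Prod.fst a)) π ∧ ∫ a, estFun β (Prod.fst a) ∂π = z.1 ∧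
    ∫⁻ a, modNorm q a.1 a.2 ^ 2 ∂π ≤ ENNReal.ofReal z.2 ∧ 0 ≤ z.2}

/-- Mixtures of couplings are couplings; this convexity is what allows mass to be split. -/
lemma convex_attainable (n : ℕ) (w : ℕ → EuclideanSpace ℝ (Fin d) × ℝ)
    (β : EuclideanSpace ℝ (Fin d)) : Convex ℝ (attainable q n w β) := by
  rintro ⟨x, r⟩ ⟨π, hπ, h2, hi, hx, hr, hr0⟩ ⟨y, s⟩ ⟨ρ, hρ, k2, ki, hy, hs, hs0⟩ a b ha hb hab
  have hab' : ENNReal.ofReal a + ENNReal.ofReal b = 1 := by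
    rw [← ENNReal.ofReal_add ha hb, hab, ENNReal.ofReal_one]
  refine ⟨ENNReal.ofReal a • π + ENNReal.ofReal b • ρ, ⟨?_⟩, ?_, ?_, ?_, ?_, ?_⟩
  · simpa using hab'
  · rw [Measure.map_add _ _ measurable_snd, Measure.map_smul, Measure.map_smul, h2, k2, ← add_smul,
      hab', one_smul]
  · exact (hi.smul_measure ENNReal.ofReal_ne_top).add_measure
      (ki.smul_measure ENNReal.ofReal_ne_top)
  · rw [integral_add_measure (hi.smul_measure ENNReal.ofReal_ne_top)
      (ki.smul_measure ENNReal.ofReal_ne_top), integral_smul_measure, integral_smul_measure, hx, hy]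
    simp [ha, hb]
  · rw [lintegral_add_measure, lintegral_smul_measure, lintegral_smul_measure]
    simp only [Prod.smul_mk, Prod.mk_add_mk, smul_eq_mul] at *
    rw [ENNReal.ofReal_add (by positivity) (by positivity), ENNReal.ofReal_mul ha,
      ENNReal.ofReal_mul hb]
    gcongr
  · simp only [Prod.smul_mk, Prod.mk_add_mk, smul_eq_mul] at *
    positivity

lemma profile_le_of_mem_attainable {n : ℕ} {w : ℕ → EuclideanSpace ℝ (Fin d) × ℝ}
    {β : EuclideanSpace ℝ (Fin d)} {r : ℝ} (h : ((0 : EuclideanSpace ℝ (Fin d)), r) ∈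
      attainable q n w β) : profile q n w β ≤ ENNReal.ofReal r := by
  obtain ⟨π, hπ, h2, hi, hx, hr, hr0⟩ := h
  have hm := (continuous_estFun β).measurable.aestronglyMeasurable (μ := π.map Prod.fst)
  refine le_trans ?_ hr
  unfold profile transportCost
  refine iInf_le_of_le (π.map Prod.fst) (iInf_le_of_le
    (Measure.isProbabilityMeasure_map measurable_fst.aemeasurable) (iInf_le_of_le ⟨?_, ?_⟩
    (iInf_le_of_le π (iInf_le_of_le hπ (iInf_le_of_le rfl (iInf_le_of_le h2 le_rfl))))))
  · exact (integrable_map_measure hm measurable_fst.aemeasurable).2 hi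
  · exact (integral_map measurable_fst.aemeasurable hm).trans hx

lemma mem_attainable [Fact (1 ≤ q)] {n : ℕ} (hn : 1 ≤ n)
    (w : ℕ → EuclideanSpace ℝ (Fin d) × ℝ) (β : EuclideanSpace ℝ (Fin d))
    (u : ℕ → EuclideanSpace ℝ (Fin d)) {r : ℝ}
    (hr : (n : ℝ)⁻¹ * ∑ i ∈ Finset.range n, vecNorm q (u i - (w i).1) ^ 2 ≤ r) :
    ((n : ℝ)⁻¹ • ∑ i ∈ Finset.range n, estFun β (u i, (w i).2), r) ∈ attainable q n w β := by
  refine ⟨empirical n (fun i => ((u i, (w i).2), w i)), isProbabilityMeasure_empirical hn _,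
    empirical_map n _ measurable_snd, integrable_empirical hn _ _, integral_empirical n _ _, ?_,
    le_trans (by positivity) hr⟩
  rw [lintegral_empirical]
  refine le_trans (le_of_eq ?_) (ENNReal.ofReal_le_ofReal hr)
  rw [ENNReal.ofReal_mul (by positivity), ENNReal.ofReal_inv_of_pos (by exact_mod_cast hn),
    ENNReal.ofReal_natCast, ENNReal.ofReal_sum_of_nonneg (fun i _ => by positivity)]
  congr 1
  exact Finset.sum_congr rfl fun i _ => modNorm_sq_of_eq rfl

lemma profile_le_of_sum_estFun_eq_zero [Fact (1 ≤ q)] {n : ℕ} (hn : 1 ≤ n)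
    (w : ℕ → EuclideanSpace ℝ (Fin d) × ℝ) (β : EuclideanSpace ℝ (Fin d))
    (u : ℕ → EuclideanSpace ℝ (Fin d))
    (hu : ∑ i ∈ Finset.range n, estFun β (u i, (w i).2) = 0) :
    profile q n w β ≤
      ENNReal.ofReal ((n : ℝ)⁻¹ * ∑ i ∈ Finset.range n, vecNorm q (u i - (w i).1) ^ 2) := by
  apply profile_le_of_mem_attainable
  simpa [hu] using mem_attainable hn w β u le_rfl

/-- The origin annihilates the estimating function whatever the response, so moving every covariate
there is admissible at finite cost. -/
lemma profile_ne_top [Fact (1 ≤ q)] {n : ℕ} (hn : 1 ≤ n)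
    (w : ℕ → EuclideanSpace ℝ (Fin d) × ℝ) (β : EuclideanSpace ℝ (Fin d)) :
    profile q n w β ≠ ⊤ :=
  ne_top_of_le_ne_top ENNReal.ofReal_ne_top
    (profile_le_of_sum_estFun_eq_zero hn w β 0 (by simp [estFun_zero]))

/-- Strong duality when all the responses vanish. -/
lemma exists_le_lagrangian_of_responses_eq_zero [Fact (1 ≤ q)] {n : ℕ} (hn : 1 ≤ n)
    {w : ℕ → EuclideanSpace ℝ (Fin d) × ℝ} {β : EuclideanSpace ℝ (Fin d)}
    (hw : ∀ i ∈ Finset.range n, (w i).2 = 0) {c : ℝ} (hc : 0 ≤ c)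
    (hcR : c < (profile q n w β).toReal) :
    ∃ l : EuclideanSpace ℝ (Fin d), ∀ u : ℕ → EuclideanSpace ℝ (Fin d),
      n * c ≤ ∑ i ∈ Finset.range n, lagrangian q β l (w i) (u i) := by
  have hn0 : (0 : ℝ) < n := by exact_mod_cast hn
  set R := (profile q n w β).toReal with hR
  -- Without a nonzero response a separating hyperplane may be vertical, so a multiplier is built by
  -- hand. For `l = (C²/ε) β` the Lagrangian is the cost plus the penalty `(C²/ε)(βᵀu)²`, and `ε` is
  -- small enough that `c (1 + ε) ≤ R`.
  set ε := (R - c) / (c + 1) with hε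
  have hεpos : 0 < ε := div_pos (by linarith) (by linarith)
  have hcε : c * (1 + ε) ≤ R := by
    have : ε * (c + 1) = R - c := by rw [hε]; field_simp
    nlinarith
  set C := vecNorm q β / ‖β‖ ^ 2 with hC
  refine ⟨(C ^ 2 / ε) • β, fun u => ?_⟩
  -- Projection onto the orthogonal complement of `β` makes any `u` feasible, at an extra distance
  -- of at most `C |βᵀu|`. The cost is then compared through `(a + b)² ≤ (1 + ε)(a² + b²/ε)`. For `β
  -- = 0` division by zero gives `C = 0` and `v = u`.
  set v : ℕ → EuclideanSpace ℝ (Fin d) := fun i => u i - (inner ℝ β (u i) / ‖β‖ ^ 2) • β with hv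
  have hβv : ∀ i, inner ℝ β (v i) = 0 := by
    intro i
    rcases eq_or_ne β 0 with h | h
    · simp [h]
    · have : ‖β‖ ≠ 0 := norm_ne_zero_iff.2 h
      simp only [hv, inner_sub_right, inner_smul_right, real_inner_self_eq_norm_sq]
      field_simp
      ring
  have h1 := profile_le_of_sum_estFun_eq_zero (q := q) hn w β v
    (Finset.sum_eq_zero fun i hi => by simp [estFun, hw i hi, hβv])
  have h2 := ENNReal.toReal_mono ENNReal.ofReal_ne_top h1
  rw [ENNReal.toReal_ofReal (by positivity), ← hR, inv_mul_eq_div, le_div_iff₀ hn0] at h2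
  have h3 : ∀ i ∈ Finset.range n, vecNorm q (v i - (w i).1) ^ 2 ≤
      (1 + ε) * lagrangian q β ((C ^ 2 / ε) • β) (w i) (u i) := by
    intro i hi
    have h4 : vecNorm q (v i - (w i).1) ≤ vecNorm q (u i - (w i).1) + C * |inner ℝ β (u i)| := by
      have : v i - (w i).1 = (u i - (w i).1) + (-(inner ℝ β (u i) / ‖β‖ ^ 2)) • β := by
        simp only [hv, neg_smul]; abel
      rw [this]
      refine (vecNorm_add_le _ _).trans (le_of_eq ?_)
      rw [vecNorm_smul, abs_neg, abs_div, abs_of_nonneg (by positivity : 0 ≤ ‖β‖ ^ 2), hC]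
      ring
    have h5 : lagrangian q β ((C ^ 2 / ε) • β) (w i) (u i) =
        vecNorm q (u i - (w i).1) ^ 2 + C ^ 2 / ε * |inner ℝ β (u i)| ^ 2 := by
      simp only [lagrangian, estFun, hw i hi, real_inner_smul_left, inner_smul_right, sq_abs]
      ring
    rw [h5]
    set V := vecNorm q (u i - (w i).1)
    set δ := |inner ℝ β (u i)|
    have h6 : vecNorm q (v i - (w i).1) ^ 2 ≤ (V + C * δ) ^ 2 :=
      pow_le_pow_left₀ (vecNorm_nonneg _) h4 2
    have h7 : (1 + ε) * (V ^ 2 + C ^ 2 / ε * δ ^ 2) - (V + C * δ) ^ 2 =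
        (ε * V - C * δ) ^ 2 / ε := by
      field_simp
      ring
    have h8 : 0 ≤ (ε * V - C * δ) ^ 2 / ε := by positivity
    linarith
  have h4 := Finset.sum_le_sum h3
  rw [← Finset.mul_sum] at h4
  have : (n : ℝ) * c * (1 + ε) ≤ n * R := by nlinarith
  nlinarith

/-- Strong duality. -/
lemma exists_le_lagrangian [Fact (1 ≤ q)] {n : ℕ} (hn : 1 ≤ n)
    {w : ℕ → EuclideanSpace ℝ (Fin d) × ℝ} {β : EuclideanSpace ℝ (Fin d)}
    {c : ℝ} (hc : 0 ≤ c) (hcR : c < (profile q n w β).toReal) :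
    ∃ l : EuclideanSpace ℝ (Fin d), ∀ u : ℕ → EuclideanSpace ℝ (Fin d),
      n * c ≤ ∑ i ∈ Finset.range n, lagrangian q β l (w i) (u i) := by
  by_cases hw : ∀ i ∈ Finset.range n, (w i).2 = 0
  · exact exists_le_lagrangian_of_responses_eq_zero hn hw hc hcR
  have hn0 : (0 : ℝ) < n := by exact_mod_cast hn
  have hmem := fun u => mem_attainable (q := q) hn w β u (le_refl _)
  have hnot : ((0 : EuclideanSpace ℝ (Fin d)), c) ∉ attainable q n w β := fun h => by
    have := ENNReal.toReal_mono ENNReal.ofReal_ne_top (profile_le_of_mem_attainable h)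
    rw [ENNReal.toReal_ofReal hc] at this
    linarith
  obtain ⟨f, hf, hle⟩ := exists_dual_ne_zero_le_of_convex (convex_attainable n w β)
    ⟨_, hmem 0⟩ hnot
  set a := (InnerProductSpace.toDual ℝ (EuclideanSpace ℝ (Fin d))).symm
    (f.comp (ContinuousLinearMap.inl ℝ _ ℝ)) with ha
  set b := f (0, 1) with hb
  have hfz : ∀ x r, f (x, r) = inner ℝ a x + b * r := by
    intro x r
    rw [ha, InnerProductSpace.toDual_symm_apply, hb]
    have : ((x, r) : EuclideanSpace ℝ (Fin d) × ℝ) = (x, 0) + r • (0, 1) := by simp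
    rw [this, map_add, map_smul]
    simp [mul_comm]
  -- The attainable set is closed under raising the cost bound, so a negative slope would violate
  -- the separation.
  have hb0 : 0 ≤ b := by
    by_contra! hneg
    have hr := fun r hr => hle _ (mem_attainable (q := q) hn w β 0 (r := r) hr)
    simp only [hfz, inner_zero_right, zero_add, Pi.zero_apply, estFun_zero, Finset.sum_const_zero,
      smul_zero] at hr
    have h1 := hr (max (c + 1)
      ((n : ℝ)⁻¹ * ∑ i ∈ Finset.range n, vecNorm q (0 - (w i).1) ^ 2)) (le_max_right _ _)
    have h2 := le_max_left (c + 1)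
      ((n : ℝ)⁻¹ * ∑ i ∈ Finset.range n, vecNorm q (0 - (w i).1) ^ 2)
    nlinarith
  rcases hb0.eq_or_lt with hb0 | hb0
  · exfalso
    have ha0 : a ≠ 0 := by
      intro h0
      apply hf
      ext z
      · simp [hfz, h0]
      · simp [hfz, ← hb0]
    -- A vertical hyperplane is impossible: with all other points at the origin, moving a point with
    -- nonzero response along `a` gives both signs to `a`'s inner product with the estimating
    -- function.
    push Not at hw
    obtain ⟨i, hi, hwi⟩ := hw
    have h1 : ∀ x : EuclideanSpace ℝ (Fin d), 0 ≤ inner ℝ a (estFun β (x, (w i).2)) := by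
      intro x
      have h2 := hle _ (hmem (Function.update 0 i x))
      rw [Finset.sum_eq_single_of_mem i hi] at h2
      · simp only [hfz, ← hb0, inner_zero_right, zero_mul, add_zero, Function.update_self,
          inner_smul_right] at h2
        exact nonneg_of_mul_nonneg_right h2 (by positivity)
      · intro j _ hj
        simp [Function.update_of_ne hj, estFun_zero]
    set y := (w i).2 with hy
    set A := ‖a‖ ^ 2
    have hA : 0 < A := by have := norm_pos_iff.2 ha0; positivity
    have h3 : ∀ t : ℝ, 0 ≤ (y - t * inner ℝ β a) * (t * A) := by
      intro t
      have := h1 (t • a)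
      simpa [estFun, inner_smul_right, A] using this
    set B := inner ℝ β a
    have h4 : ∀ t : ℝ, 0 ≤ (y - t * B) * t := fun t => by
      have := h3 t
      rw [← mul_assoc] at this
      exact nonneg_of_mul_nonneg_left this hA
    -- This `t` has the sign of `y` and keeps `|t B|` below `|y|`, so that `y + t B` still has the
    -- sign of `t`.
    set t := y / (1 + 2 * |B|)
    have h5 : t * (1 + 2 * |B|) = y := by
      have : 0 < 1 + 2 * |B| := by positivity
      simp only [t]; field_simp
    have ht : t ≠ 0 := fun h => hwi (by rw [← h5, h, zero_mul])
    have h6 := h4 (-t)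
    have h7 := neg_abs_le B
    have h8 : 0 < t ^ 2 := by positivity
    have h9 := abs_nonneg B
    rw [← h5] at h6
    nlinarith
  · refine ⟨-(b⁻¹ • a), fun u => ?_⟩
    have h1 := hle _ (hmem u)
    simp only [hfz, inner_zero_right, zero_add, inner_smul_right, inner_sum] at h1
    have h2 : ∑ i ∈ Finset.range n, lagrangian q β (-(b⁻¹ • a)) (w i) (u i) =
        n * b⁻¹ * ((n : ℝ)⁻¹ * ∑ i ∈ Finset.range n, inner ℝ a (estFun β (u i, (w i).2)) +
        b * ((n : ℝ)⁻¹ * ∑ i ∈ Finset.range n, vecNorm q (u i - (w i).1) ^ 2)) := by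
      simp only [lagrangian, inner_neg_left, real_inner_smul_left, sub_neg_eq_add,
        Finset.sum_add_distrib, ← Finset.mul_sum]
      field_simp
      ring
    rw [h2]
    calc (n : ℝ) * c = n * b⁻¹ * (b * c) := by field_simp
      _ ≤ _ := by gcongr

/-! ### Expansion of the Lagrangian around a data point. -/

/-- The residual `y - βᵀx` of the data point `(x, y)`. -/
def residual (β : EuclideanSpace ℝ (Fin d)) (w : EuclideanSpace ℝ (Fin d) × ℝ) : ℝ :=
  w.2 - inner ℝ β w.1

/-- The derivative `(y - βᵀx) ξ - (ξᵀx) β` of `ξᵀ((y - βᵀx) x)` in `x`. -/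
def gradVec (β : EuclideanSpace ℝ (Fin d)) (w : EuclideanSpace ℝ (Fin d) × ℝ)
    (ξ : EuclideanSpace ℝ (Fin d)) : EuclideanSpace ℝ (Fin d) :=
  residual β w • ξ - inner ℝ ξ w.1 • β

lemma gradVec_smul (β : EuclideanSpace ℝ (Fin d)) (w : EuclideanSpace ℝ (Fin d) × ℝ) (t : ℝ)
    (ξ : EuclideanSpace ℝ (Fin d)) : gradVec β w (t • ξ) = t • gradVec β w ξ := by
  simp only [gradVec, real_inner_smul_left, smul_sub, smul_smul]
  rw [mul_comm]

/-- The expansion is exact because the estimating function is quadratic in the covariate. -/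
lemma lagrangian_add (q : ℝ≥0∞) (β l : EuclideanSpace ℝ (Fin d))
    (w : EuclideanSpace ℝ (Fin d) × ℝ) (v : EuclideanSpace ℝ (Fin d)) :
    lagrangian q β l w (w.1 + v) = vecNorm q v ^ 2 - residual β w * inner ℝ l w.1 -
      inner ℝ (gradVec β w l) v + inner ℝ β v * inner ℝ l v := by
  simp only [lagrangian, estFun, residual, gradVec, add_sub_cancel_left, inner_smul_right,
    inner_add_right, inner_sub_left, real_inner_smul_left]
  ring

lemma abs_inner_mul_inner_le (hpq : ENNReal.HolderConjugate p q)
    (β l v : EuclideanSpace ℝ (Fin d)) :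
    |inner ℝ β v * inner ℝ l v| ≤ vecNorm p β * vecNorm p l * vecNorm q v ^ 2 := by
  rw [abs_mul]
  calc |inner ℝ β v| * |inner ℝ l v|
      ≤ (vecNorm p β * vecNorm q v) * (vecNorm p l * vecNorm q v) :=
        mul_le_mul (abs_inner_le_vecNorm_mul hpq _ _) (abs_inner_le_vecNorm_mul hpq _ _)
          (abs_nonneg _) ((abs_nonneg _).trans (abs_inner_le_vecNorm_mul hpq _ _))
    _ = _ := by ring

/-- With `D = ‖v‖_q`, Hölder's inequality leaves the scalar problem of minimizing `(1 - k) D² - V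
D`, whose minimum is `-V² / (4 (1 - k))`. -/
lemma le_lagrangian (hpq : ENNReal.HolderConjugate p q) {β l : EuclideanSpace ℝ (Fin d)}
    (hl : vecNorm p β * vecNorm p l < 1) (w : EuclideanSpace ℝ (Fin d) × ℝ)
    (u : EuclideanSpace ℝ (Fin d)) :
    -(residual β w * inner ℝ l w.1) -
      vecNorm p (gradVec β w l) ^ 2 / (4 * (1 - vecNorm p β * vecNorm p l)) ≤
      lagrangian q β l w u := by
  obtain ⟨v, rfl⟩ : ∃ v, u = w.1 + v := ⟨u - w.1, by simp⟩
  rw [lagrangian_add]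
  have h1 := (abs_le.1 (abs_inner_mul_inner_le hpq β l v)).1
  have h2 := inner_le_vecNorm_mul hpq (gradVec β w l) v
  set k := vecNorm p β * vecNorm p l
  set V := vecNorm p (gradVec β w l)
  set D := vecNorm q v
  have hk : 0 < 1 - k := by linarith
  have h3 : V * D - (1 - k) * D ^ 2 ≤ V ^ 2 / (4 * (1 - k)) := by
    rw [le_div_iff₀ (by positivity)]
    nlinarith [sq_nonneg (V - 2 * (1 - k) * D)]
  nlinarith

/-- The test displacement is half the dual vector of the gradient, the minimizer when the bilinear
remainder is dropped. -/
lemma exists_lagrangian_le (hpq : ENNReal.HolderConjugate p q) (β l : EuclideanSpace ℝ (Fin d))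
    (w : EuclideanSpace ℝ (Fin d) × ℝ) : ∃ u : EuclideanSpace ℝ (Fin d),
    lagrangian q β l w u ≤ -(residual β w * inner ℝ l w.1) -
      (1 - vecNorm p β * vecNorm p l) * vecNorm p (gradVec β w l) ^ 2 / 4 := by
  have := fact_one_le_of_holderConjugate hpq
  have : Fact (1 ≤ q) := fact_one_le_of_holderConjugate (q := p) hpq.symm
  obtain ⟨v, hv, hv2⟩ := exists_dual_vector hpq (gradVec β w l)
  refine ⟨w.1 + (1 / 2 : ℝ) • v, ?_⟩
  rw [lagrangian_add]
  have h1 := (abs_le.1 (abs_inner_mul_inner_le hpq β l ((1 / 2 : ℝ) • v))).2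
  have h2 : vecNorm q ((1 / 2 : ℝ) • v) ^ 2 ≤ vecNorm p (gradVec β w l) ^ 2 / 4 := by
    rw [vecNorm_smul, abs_of_pos (by norm_num), mul_pow]
    have := pow_le_pow_left₀ (vecNorm_nonneg v) hv 2
    linarith
  have h3 : 0 ≤ vecNorm p β * vecNorm p l := mul_nonneg (vecNorm_nonneg _) (vecNorm_nonneg _)
  have h4 : inner ℝ (gradVec β w l) ((1 / 2 : ℝ) • v) = vecNorm p (gradVec β w l) ^ 2 / 2 := by
    rw [inner_smul_right, real_inner_comm, hv2]; ring
  rw [h4]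
  have h5 := mul_le_mul_of_nonneg_left h2 h3
  linarith

/-! ### Measurability of the profile function in the data. -/

lemma lagrangian_convexComb (q : ℝ≥0∞) (β l m : EuclideanSpace ℝ (Fin d))
    (w : EuclideanSpace ℝ (Fin d) × ℝ) (u : EuclideanSpace ℝ (Fin d)) (t : ℝ) :
    lagrangian q β (t • l + (1 - t) • m) w u =
      t * lagrangian q β l w u + (1 - t) * lagrangian q β m w u := by
  simp only [lagrangian, inner_add_left, real_inner_smul_left]
  ring

lemma continuous_gradVec (β : EuclideanSpace ℝ (Fin d)) :
    Continuous fun a : (EuclideanSpace ℝ (Fin d) × ℝ) × EuclideanSpace ℝ (Fin d) =>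
      gradVec β a.1 a.2 := by
  unfold gradVec residual; fun_prop

lemma exists_ball_le_sum_lagrangian (hpq : ENNReal.HolderConjugate p q) (n : ℕ)
    (w : ℕ → EuclideanSpace ℝ (Fin d) × ℝ) (β : EuclideanSpace ℝ (Fin d)) :
    ∃ r > 0, ∀ m : EuclideanSpace ℝ (Fin d), ‖m‖ < r → ∀ u : ℕ → EuclideanSpace ℝ (Fin d),
      -1 ≤ ∑ i ∈ Finset.range n, lagrangian q β m (w i) (u i) := by
  have := fact_one_le_of_holderConjugate hpq
  set f : EuclideanSpace ℝ (Fin d) → ℝ := fun m => ∑ i ∈ Finset.range n,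
    (-(residual β (w i) * inner ℝ m (w i).1) -
      vecNorm p (gradVec β (w i) m) ^ 2 / (4 * (1 - vecNorm p β * vecNorm p m))) with hf
  have hk : Continuous fun m : EuclideanSpace ℝ (Fin d) => vecNorm p β * vecNorm p m := by
    fun_prop
  have hfc : ContinuousAt f 0 := by
    refine tendsto_finsetSum _ fun i _ => ?_
    refine Tendsto.sub (Continuous.tendsto (by fun_prop) 0) (ContinuousAt.div ?_ ?_ (by simp))
    · exact ((continuous_vecNorm.comp ((continuous_gradVec β).comp
        (Continuous.prodMk_right (w i)))).pow 2).continuousAt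
    · exact (by fun_prop : Continuous fun m : EuclideanSpace ℝ (Fin d) =>
        4 * (1 - vecNorm p β * vecNorm p m)).continuousAt
  have hf0 : f 0 = 0 := by simp [hf, gradVec]
  have h1 : ∀ᶠ m in 𝓝 (0 : EuclideanSpace ℝ (Fin d)), -1 < f m :=
    hfc.eventually (lt_mem_nhds (by rw [hf0]; norm_num))
  have h2 : ∀ᶠ m in 𝓝 (0 : EuclideanSpace ℝ (Fin d)), vecNorm p β * vecNorm p m < 1 :=
    hk.continuousAt.eventually (gt_mem_nhds (by simp))
  obtain ⟨r, hr, h⟩ := Metric.eventually_nhds_iff.1 (h1.and h2)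
  refine ⟨r, hr, fun m hm u => ?_⟩
  obtain ⟨h3, h4⟩ := h (y := m) (by simpa using hm)
  exact h3.le.trans (Finset.sum_le_sum fun i _ => le_lagrangian hpq h4 _ _)

lemma continuous_lagrangian [Fact (1 ≤ q)] (β l : EuclideanSpace ℝ (Fin d)) :
    Continuous fun a : (EuclideanSpace ℝ (Fin d) × ℝ) × EuclideanSpace ℝ (Fin d) =>
      lagrangian q β l a.1 a.2 := by
  unfold lagrangian
  have h : Continuous fun a : (EuclideanSpace ℝ (Fin d) × ℝ) × EuclideanSpace ℝ (Fin d) =>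
    vecNorm q (a.2 - a.1.1) := continuous_vecNorm.comp (by fun_prop)
  fun_prop

lemma continuous_lagrangian_right [Fact (1 ≤ q)] (β l : EuclideanSpace ℝ (Fin d))
    (w : EuclideanSpace ℝ (Fin d) × ℝ) : Continuous fun u => lagrangian q β l w u := by
  have h : Continuous fun u : EuclideanSpace ℝ (Fin d) => (w, u) := by fun_prop
  have h' := (continuous_lagrangian (q := q) β l).comp h
  simpa only [Function.comp_def] using h'

lemma le_sum_lagrangian_of_denseRange [Fact (1 ≤ q)] {n : ℕ}
    {w : ℕ → EuclideanSpace ℝ (Fin d) × ℝ} {β l : EuclideanSpace ℝ (Fin d)} {c : ℝ}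
    {D : ℕ → ℕ → EuclideanSpace ℝ (Fin d)} (hD : DenseRange D)
    (h : ∀ j, c ≤ ∑ i ∈ Finset.range n, lagrangian q β l (w i) (D j i))
    (u : ℕ → EuclideanSpace ℝ (Fin d)) :
    c ≤ ∑ i ∈ Finset.range n, lagrangian q β l (w i) (u i) := by
  refine hD.induction_on (p := fun u => c ≤ ∑ i ∈ Finset.range n, lagrangian q β l (w i) (u i)) u
    (isClosed_le continuous_const (continuous_finsetSum _ fun i _ => ?_)) h
  exact (continuous_lagrangian_right β l (w i)).comp (continuous_apply i)

/-- Duality turns the event into countably many closed conditions: multipliers and displacements may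
both be taken from dense sequences. -/
lemma lt_profile_iff (hpq : ENNReal.HolderConjugate p q) {n : ℕ} (hn : 1 ≤ n)
    (w : ℕ → EuclideanSpace ℝ (Fin d) × ℝ) (β : EuclideanSpace ℝ (Fin d)) {c : ℝ} (hc : 0 ≤ c) :
    c < (profile q n w β).toReal ↔ ∃ c' : ℚ, c < c' ∧ ∃ k : ℕ, ∀ j : ℕ,
      n * (c' : ℝ) ≤ ∑ i ∈ Finset.range n, lagrangian q β
        (TopologicalSpace.denseSeq (EuclideanSpace ℝ (Fin d)) k) (w i)
        (TopologicalSpace.denseSeq (ℕ → EuclideanSpace ℝ (Fin d)) j i) := by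
  have : Fact (1 ≤ q) := fact_one_le_of_holderConjugate (q := p) hpq.symm
  have hn0 : (0 : ℝ) < n := by exact_mod_cast hn
  constructor
  · intro h
    obtain ⟨c', hc', hc'R⟩ := exists_rat_btwn h
    obtain ⟨c₁, hc₁, hc₁R⟩ := exists_between hc'R
    have hc₁0 : 0 < c₁ := by linarith
    obtain ⟨l, hl⟩ := exists_le_lagrangian hn hc₁0.le hc₁R
    obtain ⟨r, hr, hm⟩ := exists_ball_le_sum_lagrangian hpq n w β
    -- The multipliers `(1 - s) l + s m` with `‖m‖ < r` form an open set, hence contain a dense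
    -- point. The weight solves `(1 - s) n c₁ - s = n c'`, the loss allowed by the bound `-1` near
    -- zero.
    set s := n * (c₁ - c') / (n * c₁ + 1) with hs
    have hs0 : 0 < s := div_pos (mul_pos hn0 (by linarith)) (by positivity)
    have hs2 : s * (n * c₁ + 1) = n * (c₁ - c') := by rw [hs]; field_simp
    have hc'0 : 0 < (c' : ℝ) := by linarith
    have hs1 : s < 1 := by
      rw [hs, div_lt_one (by positivity)]
      nlinarith
    obtain ⟨k, hk⟩ := (TopologicalSpace.denseRange_denseSeq
      (EuclideanSpace ℝ (Fin d))).exists_mem_open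
      (s := {x | ‖s⁻¹ • (x - (1 - s) • l)‖ < r})
      (isOpen_lt (by fun_prop) continuous_const) ⟨(1 - s) • l, by simpa using hr⟩
    refine ⟨c', hc', k, fun j => ?_⟩
    set x := TopologicalSpace.denseSeq (EuclideanSpace ℝ (Fin d)) k
    have hx : x = (1 - s) • l + (1 - (1 - s)) • (s⁻¹ • (x - (1 - s) • l)) := by
      rw [sub_sub_cancel, smul_smul, mul_inv_cancel₀ hs0.ne', one_smul]; abel
    rw [hx]
    simp only [lagrangian_convexComb]
    rw [Finset.sum_add_distrib, ← Finset.mul_sum, ← Finset.mul_sum]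
    have h1 := mul_le_mul_of_nonneg_left (hl (TopologicalSpace.denseSeq _ j))
      (by linarith : 0 ≤ 1 - s)
    have h2 := mul_le_mul_of_nonneg_left (hm _ hk (TopologicalSpace.denseSeq _ j)) hs0.le
    rw [sub_sub_cancel]
    nlinarith
  · rintro ⟨c', hc', k, hk⟩
    refine hc'.trans_le ((ENNReal.ofReal_le_iff_le_toReal (profile_ne_top hn w β)).1 ?_)
    refine le_profile_of_le_lagrangian hn
      (l := TopologicalSpace.denseSeq (EuclideanSpace ℝ (Fin d)) k) fun u => ?_
    exact le_sum_lagrangian_of_denseRange (TopologicalSpace.denseRange_denseSeq _) hk u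

lemma measurable_profile (hpq : ENNReal.HolderConjugate p q) {n : ℕ} (hn : 1 ≤ n)
    (β : EuclideanSpace ℝ (Fin d)) :
    Measurable fun w : ℕ → EuclideanSpace ℝ (Fin d) × ℝ => (profile q n w β).toReal := by
  have : Fact (1 ≤ q) := fact_one_le_of_holderConjugate (q := p) hpq.symm
  refine measurable_of_Ioi fun c => ?_
  rcases lt_or_ge c 0 with hc | hc
  · convert! MeasurableSet.univ
    exact Set.eq_univ_of_forall fun w => hc.trans_le ENNReal.toReal_nonneg
  have : (fun w : ℕ → EuclideanSpace ℝ (Fin d) × ℝ => (profile q n w β).toReal) ⁻¹' Set.Ioi c =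
      ⋃ (c' : ℚ) (_ : c < c') (k : ℕ), ⋂ j : ℕ, {w | n * (c' : ℝ) ≤
        ∑ i ∈ Finset.range n, lagrangian q β
        (TopologicalSpace.denseSeq (EuclideanSpace ℝ (Fin d)) k) (w i)
        (TopologicalSpace.denseSeq (ℕ → EuclideanSpace ℝ (Fin d)) j i)} := by
    ext w
    simp [lt_profile_iff hpq hn w β hc]
  rw [this]
  refine MeasurableSet.iUnion fun c' => MeasurableSet.iUnion fun _ => MeasurableSet.iUnion fun k =>
    MeasurableSet.iInter fun j => measurableSet_le measurable_const
    (Finset.measurable_fun_sum _ fun i _ => ?_)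
  exact (((continuous_lagrangian β _).comp (Continuous.prodMk_left _)).measurable).comp
    (measurable_pi_apply i)

/-! ### Two-sided bounds for the rescaled profile function. -/

/-- The normalized sum `n^{-1/2} ∑ (y_i - βᵀx_i) x_i`. -/
def scoreSum (β : EuclideanSpace ℝ (Fin d)) (n : ℕ) (w : ℕ → EuclideanSpace ℝ (Fin d) × ℝ) :
    EuclideanSpace ℝ (Fin d) :=
  (√(n : ℝ))⁻¹ • ∑ i ∈ Finset.range n, residual β (w i) • (w i).1

/-- The empirical quadratic term `n⁻¹ ∑ ‖(y_i - βᵀx_i) ξ - (ξᵀx_i) β‖_p²`. -/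
def empQuad (p : ℝ≥0∞) (β : EuclideanSpace ℝ (Fin d)) (n : ℕ)
    (w : ℕ → EuclideanSpace ℝ (Fin d) × ℝ) (ξ : EuclideanSpace ℝ (Fin d)) : ℝ :=
  (n : ℝ)⁻¹ * ∑ i ∈ Finset.range n, vecNorm p (gradVec β (w i) ξ) ^ 2

/-- The relative error of the linearization. -/
def linErr (p : ℝ≥0∞) (β : EuclideanSpace ℝ (Fin d)) (n : ℕ) (ξ : EuclideanSpace ℝ (Fin d)) : ℝ :=
  2 / √(n : ℝ) * (vecNorm p β * vecNorm p ξ)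

lemma vecNorm_mul_vecNorm_scaled [Fact (1 ≤ p)] (β ξ : EuclideanSpace ℝ (Fin d)) (n : ℕ) :
    vecNorm p β * vecNorm p (-(2 / √(n : ℝ)) • ξ) = linErr p β n ξ := by
  rw [vecNorm_smul, abs_neg, abs_of_nonneg (by positivity), linErr]
  ring

lemma sum_scaled [Fact (1 ≤ p)] {n : ℕ} (hn : 1 ≤ n) (w : ℕ → EuclideanSpace ℝ (Fin d) × ℝ)
    (β ξ : EuclideanSpace ℝ (Fin d)) (a : ℝ) :
    ∑ i ∈ Finset.range n, (-(residual β (w i) * inner ℝ (-(2 / √(n : ℝ)) • ξ) (w i).1) -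
      a * vecNorm p (gradVec β (w i) (-(2 / √(n : ℝ)) • ξ)) ^ 2 / 4) =
    2 * inner ℝ ξ (scoreSum β n w) - a * empQuad p β n w ξ := by
  have hn0 : (0 : ℝ) < n := by exact_mod_cast hn
  have hsq : √(n : ℝ) ^ 2 = n := Real.sq_sqrt hn0.le
  simp only [gradVec_smul, vecNorm_smul, mul_pow, sq_abs, scoreSum, empQuad, real_inner_smul_left,
    inner_smul_right, inner_sum, Finset.mul_sum, neg_sq, div_pow, hsq, ← Finset.sum_sub_distrib]
  refine Finset.sum_congr rfl fun i _ => ?_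
  field_simp
  ring

lemma le_mul_profile (hpq : ENNReal.HolderConjugate p q) {n : ℕ} (hn : 1 ≤ n)
    (w : ℕ → EuclideanSpace ℝ (Fin d) × ℝ) {β ξ : EuclideanSpace ℝ (Fin d)}
    (h : linErr p β n ξ < 1) :
    2 * inner ℝ ξ (scoreSum β n w) - empQuad p β n w ξ / (1 - linErr p β n ξ) ≤
      n * (profile q n w β).toReal := by
  have := fact_one_le_of_holderConjugate hpq
  have : Fact (1 ≤ q) := fact_one_le_of_holderConjugate (q := p) hpq.symm
  have hn0 : (0 : ℝ) < n := by exact_mod_cast hn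
  rw [← div_le_iff₀' hn0]
  refine (ENNReal.ofReal_le_iff_le_toReal (profile_ne_top hn w β)).1 ?_
  refine le_profile_of_le_lagrangian hn (l := -(2 / √(n : ℝ)) • ξ) fun u => ?_
  rw [mul_div_cancel₀ _ hn0.ne', div_eq_inv_mul, ← sum_scaled hn]
  refine Finset.sum_le_sum fun i _ => le_trans (le_of_eq ?_) (le_lagrangian hpq (by
    rwa [vecNorm_mul_vecNorm_scaled]) _ _)
  rw [vecNorm_mul_vecNorm_scaled]
  have : 1 - linErr p β n ξ ≠ 0 := by linarith
  field_simp

/-- A good multiplier may lie where the linearization is useless. The Lagrangian is affine in `l`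
and nonnegative at `l = 0`, so shrinking `ξ` to the sphere of radius `ρ` by a factor `s` retains at
least `s * r`. Coercivity will later deal with the sphere. -/
lemma mul_profile_le (hpq : ENNReal.HolderConjugate p q) {n : ℕ} (hn : 1 ≤ n)
    (w : ℕ → EuclideanSpace ℝ (Fin d) × ℝ) (β : EuclideanSpace ℝ (Fin d)) {ρ r : ℝ} (hρ : 0 < ρ)
    (hr : 0 ≤ r) (hrR : r < n * (profile q n w β).toReal) :
    ∃ (ξ : EuclideanSpace ℝ (Fin d)) (s : ℝ), ‖ξ‖ ≤ ρ ∧ 0 < s ∧ (s = 1 ∨ ‖ξ‖ = ρ) ∧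
      s * r ≤ 2 * inner ℝ ξ (scoreSum β n w) - (1 - linErr p β n ξ) * empQuad p β n w ξ := by
  have := fact_one_le_of_holderConjugate hpq
  have : Fact (1 ≤ q) := fact_one_le_of_holderConjugate (q := p) hpq.symm
  have hn0 : (0 : ℝ) < n := by exact_mod_cast hn
  have hsq : 0 < √(n : ℝ) := Real.sqrt_pos.2 hn0
  obtain ⟨l, hl⟩ := exists_le_lagrangian hn (c := r / n) (by positivity)
    (by rwa [div_lt_iff₀' hn0])
  rw [mul_div_cancel₀ _ hn0.ne'] at hl
  obtain ⟨ξ, rfl⟩ : ∃ ξ, l = -(2 / √(n : ℝ)) • ξ :=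
    ⟨-(√(n : ℝ) / 2) • l, by rw [smul_smul]; field_simp; simp⟩
  have key : ∀ s : ℝ, 0 < s → s ≤ 1 → s * r ≤ 2 * inner ℝ (s • ξ) (scoreSum β n w) -
      (1 - linErr p β n (s • ξ)) * empQuad p β n w (s • ξ) := by
    intro s hs hs1
    choose u hu using fun i => exists_lagrangian_le hpq β (-(2 / √(n : ℝ)) • (s • ξ)) (w i)
    rw [← sum_scaled hn]
    have h0 : 0 ≤ ∑ i ∈ Finset.range n, lagrangian q β 0 (w i) (u i) :=
      Finset.sum_nonneg fun i _ => by simp only [lagrangian, inner_zero_left, sub_zero]; positivity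
    calc s * r ≤ s * ∑ i ∈ Finset.range n, lagrangian q β (-(2 / √(n : ℝ)) • ξ) (w i) (u i) +
          (1 - s) * ∑ i ∈ Finset.range n, lagrangian q β 0 (w i) (u i) := by
            have h1 := mul_le_mul_of_nonneg_left (hl u) hs.le
            have h2 := mul_nonneg (by linarith : 0 ≤ 1 - s) h0
            linarith
      _ = ∑ i ∈ Finset.range n, lagrangian q β (-(2 / √(n : ℝ)) • (s • ξ)) (w i) (u i) := by
            rw [Finset.mul_sum, Finset.mul_sum, ← Finset.sum_add_distrib]
            refine Finset.sum_congr rfl fun i _ => ?_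
            rw [← lagrangian_convexComb, smul_zero, add_zero, smul_comm]
      _ ≤ _ := Finset.sum_le_sum fun i _ => by
            have := hu i
            rwa [vecNorm_mul_vecNorm_scaled] at this
  rcases le_or_gt ‖ξ‖ ρ with h | h
  · exact ⟨ξ, 1, h, one_pos, Or.inl rfl, by simpa using key 1 one_pos le_rfl⟩
  · have hξ : 0 < ‖ξ‖ := hρ.trans h
    have hnorm : ‖(ρ / ‖ξ‖) • ξ‖ = ρ := by
      rw [norm_smul, Real.norm_of_nonneg (by positivity)]; field_simp
    exact ⟨(ρ / ‖ξ‖) • ξ, ρ / ‖ξ‖, hnorm.le, by positivity, Or.inr hnorm,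
      key _ (by positivity) ((div_le_one hξ).2 h.le)⟩

/-! ### The transform of a coercive function. -/

/-- The conjugate-type transform `h ↦ sup_ξ {2 ξᵀh - G ξ}`. -/
def quadConj (G : EuclideanSpace ℝ (Fin d) → ℝ) (h : EuclideanSpace ℝ (Fin d)) : ℝ :=
  ⨆ ξ : EuclideanSpace ℝ (Fin d), (2 * inner ℝ ξ h - G ξ)

section QuadConj

variable {G : EuclideanSpace ℝ (Fin d) → ℝ} {c : ℝ}

/-- Outside the ball the objective is below its value `0` at the origin, so compactness of the ball
suffices. -/
lemma exists_maximizer (hG : Continuous G) (hG0 : G 0 = 0) (hc : 0 < c)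
    (hcG : ∀ ξ, c * ‖ξ‖ ^ 2 ≤ G ξ) (h : EuclideanSpace ℝ (Fin d)) :
    ∃ ξ₀ : EuclideanSpace ℝ (Fin d), ‖ξ₀‖ ≤ 2 * ‖h‖ / c ∧
      ∀ ξ, 2 * inner ℝ ξ h - G ξ ≤ 2 * inner ℝ ξ₀ h - G ξ₀ := by
  have hr : 0 ≤ 2 * ‖h‖ / c := by positivity
  obtain ⟨ξ₀, hξ₀, hmax⟩ := (isCompact_closedBall (0 : EuclideanSpace ℝ (Fin d))
    (2 * ‖h‖ / c)).exists_isMaxOn ⟨0, by simpa using hr⟩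
    (f := fun ξ => 2 * inner ℝ ξ h - G ξ) (by fun_prop)
  refine ⟨ξ₀, by simpa using hξ₀, fun ξ => ?_⟩
  rcases le_or_gt ‖ξ‖ (2 * ‖h‖ / c) with hξ | hξ
  · exact hmax (by simpa using hξ)
  · have h0 := hmax (show (0 : EuclideanSpace ℝ (Fin d)) ∈ _ by simpa using hr)
    simp only [Set.mem_ofPred_eq, inner_zero_left, mul_zero, hG0, sub_zero] at h0
    refine le_trans ?_ h0
    have h1 := real_inner_le_norm ξ h
    have h2 := hcG ξ
    rw [div_lt_iff₀ hc] at hξ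
    have h3 : 2 * ‖h‖ * ‖ξ‖ ≤ ‖ξ‖ * c * ‖ξ‖ :=
      mul_le_mul_of_nonneg_right hξ.le (norm_nonneg ξ)
    nlinarith

lemma isGreatest_quadConj (hG : Continuous G) (hG0 : G 0 = 0) (hc : 0 < c)
    (hcG : ∀ ξ, c * ‖ξ‖ ^ 2 ≤ G ξ) (h : EuclideanSpace ℝ (Fin d)) :
    IsGreatest (Set.range fun ξ : EuclideanSpace ℝ (Fin d) => 2 * inner ℝ ξ h - G ξ)
      (quadConj G h) := by
  obtain ⟨ξ₀, -, hmax⟩ := exists_maximizer hG hG0 hc hcG h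
  have hg : IsGreatest (Set.range fun ξ : EuclideanSpace ℝ (Fin d) => 2 * inner ℝ ξ h - G ξ)
      (2 * inner ℝ ξ₀ h - G ξ₀) := by
    refine ⟨⟨ξ₀, rfl⟩, ?_⟩
    rintro _ ⟨ξ, rfl⟩
    exact hmax ξ
  rw [quadConj, iSup, hg.csSup_eq]
  exact hg

lemma le_quadConj (hG : Continuous G) (hG0 : G 0 = 0) (hc : 0 < c)
    (hcG : ∀ ξ, c * ‖ξ‖ ^ 2 ≤ G ξ) (h ξ : EuclideanSpace ℝ (Fin d)) :
    2 * inner ℝ ξ h - G ξ ≤ quadConj G h :=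
  (isGreatest_quadConj hG hG0 hc hcG h).2 ⟨ξ, rfl⟩

lemma quadConj_nonneg (hG : Continuous G) (hG0 : G 0 = 0) (hc : 0 < c)
    (hcG : ∀ ξ, c * ‖ξ‖ ^ 2 ≤ G ξ) (h : EuclideanSpace ℝ (Fin d)) : 0 ≤ quadConj G h := by
  simpa [hG0] using le_quadConj hG hG0 hc hcG h 0

/-- A finite supremum of affine functions of `h` is convex, hence continuous in finite dimension. -/
lemma continuous_quadConj (hG : Continuous G) (hG0 : G 0 = 0) (hc : 0 < c)
    (hcG : ∀ ξ, c * ‖ξ‖ ^ 2 ≤ G ξ) : Continuous (quadConj G) := by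
  have hconv : ConvexOn ℝ Set.univ (quadConj G) := by
    refine ⟨convex_univ, fun x _ y _ a b ha hb hab => ?_⟩
    refine ciSup_le fun ξ => ?_
    have hx := mul_le_mul_of_nonneg_left (le_quadConj hG hG0 hc hcG x ξ) ha
    have hy := mul_le_mul_of_nonneg_left (le_quadConj hG hG0 hc hcG y ξ) hb
    rw [inner_add_right, inner_smul_right, inner_smul_right, smul_eq_mul, smul_eq_mul]
    have : G ξ = a * G ξ + b * G ξ := by rw [← add_mul, hab, one_mul]
    linarith
  exact continuousOn_univ.1 (hconv.continuousOn isOpen_univ)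

end QuadConj

/-! ### The population quadratic term: continuity, coercivity and lower bounds. -/

section Population

variable {Ω : Type*} [MeasurableSpace Ω] {μ : Measure Ω}
  {X : Ω → EuclideanSpace ℝ (Fin d)} {e : Ω → ℝ} {β : EuclideanSpace ℝ (Fin d)} {σ : ℝ}

/-- The quadratic-type term `ξ ↦ E‖e ξ - (ξᵀX) β‖_p²`. -/
def popQuad (μ : Measure Ω) (p : ℝ≥0∞) (X : Ω → EuclideanSpace ℝ (Fin d)) (e : Ω → ℝ)
    (β ξ : EuclideanSpace ℝ (Fin d)) : ℝ :=
  ∫ ω, vecNorm p (e ω • ξ - inner ℝ ξ (X ω) • β) ^ 2 ∂μ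

lemma limitValue_eq_quadConj (z : EuclideanSpace ℝ (Fin d)) :
    limitValue μ p X e β σ z = quadConj (popQuad μ p X e β) (σ • z) := by
  simp only [limitValue, quadConj, limitObjective, popQuad, inner_smul_right, mul_assoc]

lemma limitObjective_eq (z ξ : EuclideanSpace ℝ (Fin d)) :
    limitObjective μ p X e β σ z ξ = 2 * inner ℝ ξ (σ • z) - popQuad μ p X e β ξ := by
  simp only [limitObjective, popQuad, inner_smul_right, mul_assoc]

lemma popQuad_zero [Fact (1 ≤ p)] : popQuad μ p X e β 0 = 0 := by
  simp [popQuad]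

lemma popQuad_nonneg (ξ : EuclideanSpace ℝ (Fin d)) : 0 ≤ popQuad μ p X e β ξ :=
  integral_nonneg fun ω => by positivity

lemma vecNorm_grad_le [Fact (1 ≤ p)] {C : ℝ}
    (hC : ∀ x : EuclideanSpace ℝ (Fin d), vecNorm p x ≤ C * ‖x‖) (a : ℝ)
    (ξ x β : EuclideanSpace ℝ (Fin d)) (hC0 : 0 < C) :
    vecNorm p (a • ξ - inner ℝ ξ x • β) ≤ C * (|a| + ‖x‖ * ‖β‖) * ‖ξ‖ := by
  refine (hC _).trans ?_
  rw [mul_assoc]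
  gcongr
  refine (norm_sub_le _ _).trans ?_
  rw [norm_smul, norm_smul, Real.norm_eq_abs, Real.norm_eq_abs]
  have h1 := mul_le_mul_of_nonneg_right (abs_real_inner_le_norm ξ x) (norm_nonneg β)
  linarith

lemma memLp_grad_bound (hX : MemLp X 2 μ) (he : MemLp e 2 μ) (C : ℝ) :
    MemLp (fun ω => C * (|e ω| + ‖X ω‖ * ‖β‖)) 2 μ :=
  ((he.abs).add (hX.norm.mul_const ‖β‖)).const_mul C

lemma aestronglyMeasurable_vecNorm_grad [Fact (1 ≤ p)] (hX : MemLp X 2 μ) (he : MemLp e 2 μ)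
    (ξ : EuclideanSpace ℝ (Fin d)) :
    AEStronglyMeasurable (fun ω => vecNorm p (e ω • ξ - inner ℝ ξ (X ω) • β)) μ := by
  refine continuous_vecNorm.comp_aestronglyMeasurable ?_
  exact (he.1.smul_const ξ).sub ((aestronglyMeasurable_const.inner hX.1).smul_const β)

lemma memLp_vecNorm_grad [Fact (1 ≤ p)] (hX : MemLp X 2 μ) (he : MemLp e 2 μ)
    (ξ : EuclideanSpace ℝ (Fin d)) :
    MemLp (fun ω => vecNorm p (e ω • ξ - inner ℝ ξ (X ω) • β)) 2 μ := by
  obtain ⟨C, hC0, hC⟩ := exists_vecNorm_le d p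
  refine ((memLp_grad_bound (β := β) hX he C).mul_const ‖ξ‖).mono
    (aestronglyMeasurable_vecNorm_grad hX he ξ) (ae_of_all _ fun ω => ?_)
  rw [Real.norm_of_nonneg (vecNorm_nonneg _), Real.norm_of_nonneg (by positivity)]
  exact vecNorm_grad_le hC _ _ _ _ hC0

lemma continuous_popQuad [Fact (1 ≤ p)] (hX : MemLp X 2 μ) (he : MemLp e 2 μ) :
    Continuous (popQuad μ p X e β) := by
  obtain ⟨C, hC0, hC⟩ := exists_vecNorm_le d p
  refine continuous_iff_continuousAt.2 fun ξ₀ => ?_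
  refine continuousAt_of_dominated
    (bound := fun ω => (C * (|e ω| + ‖X ω‖ * ‖β‖) * (‖ξ₀‖ + 1)) ^ 2)
    (Eventually.of_forall fun ξ => (aestronglyMeasurable_vecNorm_grad hX he ξ).pow 2) ?_
    ((memLp_grad_bound (β := β) hX he C).mul_const (‖ξ₀‖ + 1)).integrable_sq
    (ae_of_all _ fun ω => ?_)
  · filter_upwards [Metric.ball_mem_nhds ξ₀ one_pos] with ξ hξ
    refine ae_of_all _ fun ω => ?_
    rw [Real.norm_of_nonneg (by positivity)]
    refine pow_le_pow_left₀ (vecNorm_nonneg _) ((vecNorm_grad_le hC _ _ _ _ hC0).trans ?_) 2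
    gcongr
    have := norm_sub_norm_le ξ ξ₀
    rw [Metric.mem_ball, dist_eq_norm] at hξ
    linarith
  · have : Continuous fun ξ : EuclideanSpace ℝ (Fin d) =>
      vecNorm p (e ω • ξ - inner ℝ ξ (X ω) • β) := continuous_vecNorm.comp (by fun_prop)
    exact (this.pow 2).continuousAt

/-- In the Euclidean norm the square expands, and the cross term vanishes by independence and `E e =
0`; equivalence of norms then yields coercivity for every `p`. -/
lemma integral_mul_sq_le [IsProbabilityMeasure μ] (hXe : IndepFun X e μ) (hX : MemLp X 2 μ)
    (he : MemLp e 2 μ)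
    (hmean : ∫ ω, e ω ∂μ = 0) (ξ : EuclideanSpace ℝ (Fin d)) :
    (∫ ω, e ω ^ 2 ∂μ) * ‖ξ‖ ^ 2 ≤ ∫ ω, ‖e ω • ξ - inner ℝ ξ (X ω) • β‖ ^ 2 ∂μ := by
  have hU : MemLp (fun ω => inner ℝ ξ (X ω)) 2 μ := hX.const_inner ξ
  have hind : IndepFun e (fun ω => inner ℝ ξ (X ω)) μ :=
    hXe.symm.comp measurable_id (by fun_prop : Measurable fun x => inner ℝ ξ x)
  have hcross : ∫ ω, e ω * inner ℝ ξ (X ω) ∂μ = 0 := by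
    rw [hind.integral_fun_mul_eq_mul_integral he.1 hU.1, hmean, zero_mul]
  have hi1 : Integrable (fun ω => e ω ^ 2 * ‖ξ‖ ^ 2) μ := he.integrable_sq.mul_const _
  have hi2 : Integrable (fun ω => e ω * inner ℝ ξ (X ω) * (2 * inner ℝ ξ β)) μ :=
    (he.integrable_mul hU).mul_const _
  have hi3 : Integrable (fun ω => inner ℝ ξ (X ω) ^ 2 * ‖β‖ ^ 2) μ :=
    hU.integrable_sq.mul_const _
  have hexp : ∀ ω, ‖e ω • ξ - inner ℝ ξ (X ω) • β‖ ^ 2 = e ω ^ 2 * ‖ξ‖ ^ 2 -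
      e ω * inner ℝ ξ (X ω) * (2 * inner ℝ ξ β) + inner ℝ ξ (X ω) ^ 2 * ‖β‖ ^ 2 := by
    intro ω
    rw [norm_sub_sq_real, norm_smul, norm_smul, mul_pow, mul_pow, Real.norm_eq_abs, sq_abs,
      Real.norm_eq_abs, sq_abs, real_inner_smul_left, inner_smul_right]
    ring
  simp only [hexp]
  rw [integral_add (hi1.sub' hi2) hi3, integral_sub hi1 hi2, integral_mul_const,
    integral_mul_const, hcross, zero_mul, sub_zero]
  have : 0 ≤ ∫ ω, inner ℝ ξ (X ω) ^ 2 * ‖β‖ ^ 2 ∂μ := integral_nonneg fun ω => by positivity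
  linarith

lemma exists_le_popQuad [Fact (1 ≤ p)] [IsProbabilityMeasure μ]
    (hXe : IndepFun X e μ) (hX : MemLp X 2 μ) (he : MemLp e 2 μ)
    (hmean : ∫ ω, e ω ∂μ = 0) (hpos : 0 < ∫ ω, e ω ^ 2 ∂μ) :
    ∃ c > 0, ∀ ξ : EuclideanSpace ℝ (Fin d), c * ‖ξ‖ ^ 2 ≤ popQuad μ p X e β ξ := by
  obtain ⟨C, hC0, hC⟩ := exists_norm_le_vecNorm d p
  refine ⟨(∫ ω, e ω ^ 2 ∂μ) / C ^ 2, by positivity, fun ξ => ?_⟩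
  rw [div_mul_eq_mul_div, div_le_iff₀ (by positivity)]
  refine (integral_mul_sq_le (β := β) hXe hX he hmean ξ).trans ?_
  rw [popQuad, ← integral_mul_const]
  refine integral_mono_of_nonneg (ae_of_all _ fun ω => by positivity)
    ((memLp_vecNorm_grad hX he ξ).integrable_sq.mul_const _) (ae_of_all _ fun ω => ?_)
  have := pow_le_pow_left₀ (norm_nonneg _) (hC (e ω • ξ - inner ℝ ξ (X ω) • β)) 2
  simp only
  linarith [mul_pow C (vecNorm p (e ω • ξ - inner ℝ ξ (X ω) • β)) 2]

/-- The reverse triangle inequality bounds the integrand below by `(|e| a - W)²`. Independence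
factors the cross term, and `E W² ≥ (E W)²` leaves a square in `a E|e| - E W` to discard. -/
lemma le_popQuad_of_indep [Fact (1 ≤ p)] [IsProbabilityMeasure μ]
    (hXe : IndepFun X e μ) (hX : MemLp X 2 μ) (he : MemLp e 2 μ) (ξ : EuclideanSpace ℝ (Fin d)) :
    vecNorm p ξ ^ 2 * ((∫ ω, e ω ^ 2 ∂μ) - (∫ ω, |e ω| ∂μ) ^ 2) ≤ popQuad μ p X e β ξ := by
  set a := vecNorm p ξ
  have hU : MemLp (fun ω => |inner ℝ ξ (X ω)| * vecNorm p β) 2 μ :=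
    (hX.const_inner ξ).abs.mul_const _
  set W : Ω → ℝ := fun ω => |inner ℝ ξ (X ω)| * vecNorm p β with hW
  have hind : IndepFun (fun ω => |e ω|) W μ :=
    hXe.symm.comp (by fun_prop : Measurable fun t : ℝ => |t|)
      (by fun_prop : Measurable fun x => |inner ℝ ξ x| * vecNorm p β)
  have hcross : ∫ ω, |e ω| * W ω ∂μ = (∫ ω, |e ω| ∂μ) * ∫ ω, W ω ∂μ :=
    hind.integral_fun_mul_eq_mul_integral he.abs.1 hU.1
  have hi1 : Integrable (fun ω => a ^ 2 * e ω ^ 2) μ := he.integrable_sq.const_mul _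
  have hi2 : Integrable (fun ω => 2 * a * (|e ω| * W ω)) μ :=
    (he.abs.integrable_mul hU).const_mul _
  have hi3 : Integrable (fun ω => W ω ^ 2) μ := hU.integrable_sq
  have hexp : ∀ ω, (|e ω| * a - W ω) ^ 2 = a ^ 2 * e ω ^ 2 - 2 * a * (|e ω| * W ω) + W ω ^ 2 := by
    intro ω
    rw [← sq_abs (e ω)]
    ring
  have hle : ∫ ω, (|e ω| * a - W ω) ^ 2 ∂μ ≤ popQuad μ p X e β ξ := by
    refine integral_mono_of_nonneg (ae_of_all _ fun ω => by positivity)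
      (memLp_vecNorm_grad hX he ξ).integrable_sq (ae_of_all _ fun ω => ?_)
    have h := abs_vecNorm_sub_le (p := p) (e ω • ξ) (inner ℝ ξ (X ω) • β)
    rw [vecNorm_smul, vecNorm_smul] at h
    simp only
    rw [← sq_abs (|e ω| * a - W ω)]
    exact pow_le_pow_left₀ (abs_nonneg _) h 2
  simp only [hexp] at hle
  rw [integral_add (hi1.sub' hi2) hi3, integral_sub hi1 hi2, integral_const_mul,
    integral_const_mul, hcross] at hle
  have hvar : (∫ ω, W ω ∂μ) ^ 2 ≤ ∫ ω, W ω ^ 2 ∂μ := by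
    have h1 := variance_eq_sub hU
    have h2 := variance_nonneg W μ
    simp only [Pi.pow_apply] at h1
    linarith
  nlinarith [sq_nonneg (a * (∫ ω, |e ω| ∂μ) - ∫ ω, W ω ∂μ)]

/-- After Hölder's inequality this is `2 σ a b - a² D ≤ σ² b² / D` with `a = ‖ξ‖_p` and `b = ‖z‖_q`.
-/
lemma limitValue_le [IsProbabilityMeasure μ] (hpq : ENNReal.HolderConjugate p q)
    (hXe : IndepFun X e μ) (hX : MemLp X 2 μ) (he : MemLp e 2 μ) (hσ : σ ^ 2 = ∫ ω, e ω ^ 2 ∂μ)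
    (hlt : (∫ ω, |e ω| ∂μ) ^ 2 < ∫ ω, e ω ^ 2 ∂μ) (hσ0 : 0 ≤ σ)
    (z : EuclideanSpace ℝ (Fin d)) :
    limitValue μ p X e β σ z ≤ (∫ ω, e ω ^ 2 ∂μ) / ((∫ ω, e ω ^ 2 ∂μ) - (∫ ω, |e ω| ∂μ) ^ 2) *
      vecNorm q z ^ 2 := by
  have := fact_one_le_of_holderConjugate hpq
  refine ciSup_le fun ξ => ?_
  rw [limitObjective_eq, inner_smul_right]
  have h1 := le_popQuad_of_indep (p := p) (β := β) hXe hX he ξ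
  have h2 := mul_le_mul_of_nonneg_left (inner_le_vecNorm_mul hpq ξ z) hσ0
  set D := (∫ ω, e ω ^ 2 ∂μ) - (∫ ω, |e ω| ∂μ) ^ 2
  have hD : 0 < D := by simp only [D]; linarith
  rw [← hσ, div_mul_eq_mul_div, le_div_iff₀ hD]
  nlinarith [sq_nonneg (vecNorm p ξ * D - σ * vecNorm q z)]

lemma isGreatest_limitObjective_zero [Fact (1 ≤ p)] (z : EuclideanSpace ℝ (Fin d)) :
    IsGreatest (Set.range (limitObjective μ p X e β 0 z)) 0 := by
  refine ⟨⟨0, ?_⟩, ?_⟩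
  · rw [limitObjective_eq, popQuad_zero]; simp
  · rintro _ ⟨ξ, rfl⟩
    rw [limitObjective_eq]
    have := popQuad_nonneg (μ := μ) (p := p) (X := X) (e := e) (β := β) ξ
    simpa using this

lemma limitValue_zero [Fact (1 ≤ p)] (z : EuclideanSpace ℝ (Fin d)) :
    limitValue μ p X e β 0 z = 0 :=
  isGreatest_limitObjective_zero z |>.csSup_eq

lemma stochDominated_of_le {Ω' : Type*} [MeasurableSpace Ω'] {ν : Measure Ω'} {A B : Ω' → ℝ}
    (h : ∀ ω, A ω ≤ B ω) : StochDominated A ν B ν :=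
  fun _ => measure_mono fun ω hω => lt_of_lt_of_le hω (h ω)

end Population

/-! ### The first absolute moment of a centered Gaussian. -/

lemma integral_abs_gaussianReal_sq (v : ℝ≥0) :
    (∫ x, |x| ∂(gaussianReal 0 v)) ^ 2 = 2 / Real.pi * v := by
  rcases eq_or_ne v 0 with rfl | hv
  · simp
  have hv0 : (0 : ℝ) < v := by exact_mod_cast pos_iff_ne_zero.2 hv
  have h1 : ∫ x, |x| ∂(gaussianReal 0 v) = (√(2 * Real.pi * v))⁻¹ * (2 * v) := by
    rw [integral_gaussianReal_eq_integral_smul hv]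
    have h2 : ∀ x : ℝ, gaussianPDFReal 0 v x • |x| =
        (√(2 * Real.pi * v))⁻¹ * (|x| ^ (1 : ℝ) * Real.exp (-(2 * (v : ℝ))⁻¹ * |x| ^ (2 : ℝ))) := by
      intro x
      rw [gaussianPDFReal, smul_eq_mul, Real.rpow_one, Real.rpow_two, sq_abs, sub_zero,
        neg_div, neg_mul, div_eq_inv_mul]
      ring
    simp only [h2]
    rw [integral_const_mul,
      integral_comp_abs (f := fun x => x ^ (1 : ℝ) * Real.exp (-(2 * (v : ℝ))⁻¹ * x ^ (2 : ℝ))),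
      integral_rpow_mul_exp_neg_mul_rpow (by norm_num) (by norm_num) (by positivity)]
    norm_num [Real.rpow_neg_one]
    exact Or.inl (by ring)
  rw [h1, mul_pow, inv_pow, Real.sq_sqrt (by positivity)]
  field_simp

/-! ### The multivariate central limit theorem. -/

section CentralLimit

variable {Ω Ω' : Type*} [MeasurableSpace Ω] [MeasurableSpace Ω'] {μ : Measure Ω} {ν : Measure Ω'}
  {F : Type*} [NormedAddCommGroup F] [InnerProductSpace ℝ F] [FiniteDimensional ℝ F]
  [MeasurableSpace F] [BorelSpace F]

lemma charFun_map_eq_charFun_map_inner {H : Ω → F} (hH : AEMeasurable H μ) (t : F) :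
    charFun (μ.map H) t = charFun (μ.map fun ω => inner ℝ t (H ω)) 1 := by
  rw [charFun_apply, charFun_apply, integral_map hH (by fun_prop),
    integral_map (by fun_prop) (by fun_prop)]
  simp [real_inner_comm]

/-- The central limit theorem in a finite-dimensional inner product space. -/
lemma tendstoInDistribution_of_charFun [IsProbabilityMeasure μ] [IsProbabilityMeasure ν]
    {V : ℕ → Ω → F} {W : Ω' → F}
    (hindep : iIndepFun V μ) (hident : ∀ i, IdentDistrib (V i) (V 0) μ μ) (hV : MemLp (V 0) 2 μ)
    (hmean : ∫ ω, V 0 ω ∂μ = 0) (hW : AEMeasurable W ν)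
    (hchar : ∀ t : F, charFun (ν.map W) t =
      Complex.exp (-((∫ ω, inner ℝ t (V 0 ω) ^ 2 ∂μ : ℝ) : ℂ) / 2)) :
    TendstoInDistribution (fun (n : ℕ) ω => (√(n : ℝ))⁻¹ • ∑ k ∈ Finset.range n, V k ω) atTop W
      (fun _ => μ) ν where
  forall_aemeasurable n :=
    (Finset.aemeasurable_fun_sum _ fun i _ => (hident i).aemeasurable_fst).const_smul _
  tendsto := by
    have hVm : ∀ i, AEMeasurable (V i) μ := fun i => (hident i).aemeasurable_fst
    refine ProbabilityMeasure.tendsto_iff_tendsto_charFun.2 fun t => ?_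
    have hmeas : Measurable fun x : F => inner ℝ t x := by fun_prop
    have hX : MemLp (fun ω => inner ℝ t (V 0 ω)) 2 μ := hV.const_inner t
    have hXmean : ∫ ω, inner ℝ t (V 0 ω) ∂μ = 0 := by
      rw [integral_inner (hV.integrable (by norm_num)), hmean, inner_zero_right]
    have hvar : Var[fun ω => inner ℝ t (V 0 ω); μ] = ∫ ω, inner ℝ t (V 0 ω) ^ 2 ∂μ := by
      rw [variance_of_integral_eq_zero hX.1.aemeasurable hXmean]
    -- Cramér–Wold: the characteristic function at `t` is that of the projection along `t` at
    -- frequency `1`.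
    have hclt := tendstoInDistribution_inv_sqrt_mul_sum_sub (P := μ)
      (X := fun i ω => inner ℝ t (V i ω)) (Y := id)
      (P' := gaussianReal 0 Var[fun ω => inner ℝ t (V 0 ω); μ].toNNReal)
      HasLaw.id hX (hindep.comp (fun _ x => inner ℝ t x) fun _ => hmeas)
      (fun i => (hident i).comp hmeas)
    have h1 := ProbabilityMeasure.tendsto_iff_tendsto_charFun.1 hclt.tendsto 1
    simp only [ProbabilityMeasure.coe_mk, Measure.map_id, charFun_gaussianReal, hvar] at h1 ⊢
    rw [hchar t]
    have hnn : 0 ≤ ∫ ω, inner ℝ t (V 0 ω) ^ 2 ∂μ := integral_nonneg fun ω => by positivity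
    convert! h1 using 2 with n
    · rw [charFun_map_eq_charFun_map_inner (by fun_prop)]
      congr 2
      ext ω
      simp [inner_smul_right, inner_sum, hXmean]
    · rw [Real.coe_toNNReal _ hnn]
      simp [neg_div]

end CentralLimit

section ScoreLimit

variable {Ω Ω' : Type*} [MeasurableSpace Ω] [MeasurableSpace Ω'] {μ : Measure Ω} {ν : Measure Ω'}

lemma dotProduct_secondMoment {X : Ω → EuclideanSpace ℝ (Fin d)} (hX : MemLp X 2 μ)
    (t : EuclideanSpace ℝ (Fin d)) :
    (t : Fin d → ℝ) ⬝ᵥ (secondMoment μ X).mulVec t = ∫ ω, inner ℝ t (X ω) ^ 2 ∂μ := by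
  have hXi : ∀ i, MemLp (fun ω => X ω i) 2 μ := fun i => by
    simpa [EuclideanSpace.inner_single_left] using
      hX.const_inner (𝕜 := ℝ) (EuclideanSpace.single i (1 : ℝ))
  have hexp : ∀ ω, inner ℝ t (X ω) ^ 2 = ∑ i, ∑ j, t i * (t j * (X ω i * X ω j)) := by
    intro ω
    rw [inner_eq_sum, sq, Finset.sum_mul_sum]
    exact Finset.sum_congr rfl fun i _ => Finset.sum_congr rfl fun j _ => by ring
  have hij : ∀ i j, Integrable (fun ω => t i * (t j * (X ω i * X ω j))) μ := fun i j =>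
    (((hXi i).integrable_mul (hXi j)).const_mul _).const_mul _
  simp only [hexp]
  rw [integral_finsetSum _ fun i _ => integrable_finsetSum _ fun j _ => hij i j]
  simp only [dotProduct, Matrix.mulVec, secondMoment, Matrix.of_apply]
  refine Finset.sum_congr rfl fun i _ => ?_
  rw [integral_finsetSum _ fun j _ => hij i j, Finset.mul_sum]
  refine Finset.sum_congr rfl fun j _ => ?_
  rw [integral_const_mul, integral_const_mul]
  ring

lemma posSemidef_secondMoment {X : Ω → EuclideanSpace ℝ (Fin d)} (hX : MemLp X 2 μ) :
    (secondMoment μ X).PosSemidef := by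
  refine Matrix.PosSemidef.of_dotProduct_mulVec_nonneg ?_ fun x => ?_
  · ext i j
    simp [secondMoment, mul_comm]
  · have h := dotProduct_secondMoment hX (WithLp.toLp 2 x)
    simp only [star_trivial]
    refine le_of_le_of_eq ?_ h.symm
    exact integral_nonneg fun ω => by positivity

/-- Convergence in distribution of the normalized scores `n^{-1/2} ∑ e_i X_i` to `σ Z`. -/
lemma tendstoInDistribution_score [IsProbabilityMeasure μ] [IsProbabilityMeasure ν]
    {X : ℕ → Ω → EuclideanSpace ℝ (Fin d)} {e : ℕ → Ω → ℝ} {σ : ℝ}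
    (hindep : iIndepFun (fun i ω => (X i ω, e i ω)) μ)
    (hident : ∀ i, IdentDistrib (fun ω => (X i ω, e i ω)) (fun ω => (X 0 ω, e 0 ω)) μ μ)
    (hXe : IndepFun (X 0) (e 0) μ) (hX : MemLp (X 0) 2 μ) (he : MemLp (e 0) 2 μ)
    (hmean : ∫ ω, e 0 ω ∂μ = 0) (hσ : σ ^ 2 = ∫ ω, e 0 ω ^ 2 ∂μ)
    {Z : Ω' → EuclideanSpace ℝ (Fin d)}
    (hZ : HasLaw Z (multivariateGaussian 0 (secondMoment μ (X 0))) ν) :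
    TendstoInDistribution (fun (n : ℕ) ω => (√(n : ℝ))⁻¹ • ∑ k ∈ Finset.range n, e k ω • X k ω)
      atTop (fun ω => σ • Z ω) (fun _ => μ) ν := by
  have hmeas : Measurable fun a : EuclideanSpace ℝ (Fin d) × ℝ => a.2 • a.1 := by fun_prop
  have hindep0 : ∀ t : EuclideanSpace ℝ (Fin d),
      ∫ ω, inner ℝ t (e 0 ω • X 0 ω) ^ 2 ∂μ =
        (∫ ω, e 0 ω ^ 2 ∂μ) * ∫ ω, inner ℝ t (X 0 ω) ^ 2 ∂μ := by
    intro t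
    have hind : IndepFun (fun ω => e 0 ω ^ 2) (fun ω => inner ℝ t (X 0 ω) ^ 2) μ :=
      hXe.symm.comp (by fun_prop : Measurable fun s : ℝ => s ^ 2)
        (by fun_prop : Measurable fun x => inner ℝ t x ^ 2)
    simp only [inner_smul_right, mul_pow]
    exact hind.integral_fun_mul_eq_mul_integral (he.1.pow 2)
      ((aestronglyMeasurable_const.inner hX.1).pow 2)
  -- Second moments of `X` and `e` suffice because independence factors `E[e² ‖X‖²]`.
  have hVmem : MemLp (fun ω => e 0 ω • X 0 ω) 2 μ := by
    refine (memLp_two_iff_integrable_sq_norm (he.1.smul hX.1)).2 ?_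
    have hind : IndepFun (fun ω => e 0 ω ^ 2) (fun ω => ‖X 0 ω‖ ^ 2) μ :=
      hXe.symm.comp (by fun_prop : Measurable fun s : ℝ => s ^ 2)
        (by fun_prop : Measurable fun x : EuclideanSpace ℝ (Fin d) => ‖x‖ ^ 2)
    have h := hind.integrable_mul he.integrable_sq hX.norm.integrable_sq
    refine h.congr (ae_of_all _ fun ω => ?_)
    simp [norm_smul, mul_pow]
  refine tendstoInDistribution_of_charFun (V := fun k ω => e k ω • X k ω)
    (hindep.comp (fun _ a => a.2 • a.1) fun _ => hmeas)
    (fun i => (hident i).comp hmeas) hVmem ?_ (hZ.aemeasurable.const_smul σ) fun t => ?_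
  · rw [hXe.symm.integral_fun_smul_eq_smul_integral he.1 hX.1, hmean, zero_smul]
  · rw [charFun_map_eq_charFun_map_inner (H := fun ω => σ • Z ω) (hZ.aemeasurable.const_smul σ)]
    have h1 : (fun ω => inner ℝ t (σ • Z ω)) = fun ω => inner ℝ (σ • t) (Z ω) := by
      ext ω; rw [inner_smul_right, real_inner_smul_left]
    rw [h1, ← charFun_map_eq_charFun_map_inner hZ.aemeasurable, hZ.map_eq,
      charFun_multivariateGaussian (posSemidef_secondMoment hX), dotProduct_secondMoment hX,
      hindep0, ← hσ]
    simp only [real_inner_smul_left, mul_pow, integral_const_mul, inner_zero_right]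
    simp [neg_div]

end ScoreLimit

/-! ### A uniform law of large numbers on balls. -/

section LargeNumbers

variable {Ω : Type*} [MeasurableSpace Ω] {μ : Measure Ω} [IsProbabilityMeasure μ]

/-- The function `ξ ↦ ‖a ξ - (ξᵀx) β‖_p²` on a ball. -/
def quadOnBall (p : ℝ≥0∞) [Fact (1 ≤ p)] (β : EuclideanSpace ℝ (Fin d)) (ρ : ℝ) :
    C(EuclideanSpace ℝ (Fin d) × ℝ, C(Metric.closedBall (0 : EuclideanSpace ℝ (Fin d)) ρ, ℝ)) :=
  ContinuousMap.curry ⟨fun a => vecNorm p (a.1.2 • (a.2 : EuclideanSpace ℝ (Fin d)) -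
    inner ℝ (a.2 : EuclideanSpace ℝ (Fin d)) a.1.1 • β) ^ 2,
    (continuous_vecNorm.comp (by fun_prop)).pow 2⟩

lemma quadOnBall_apply [Fact (1 ≤ p)] (β : EuclideanSpace ℝ (Fin d)) (ρ : ℝ)
    (a : EuclideanSpace ℝ (Fin d) × ℝ)
    (ξ : Metric.closedBall (0 : EuclideanSpace ℝ (Fin d)) ρ) :
    quadOnBall p β ρ a ξ = vecNorm p (a.2 • (ξ : EuclideanSpace ℝ (Fin d)) -
      inner ℝ (ξ : EuclideanSpace ℝ (Fin d)) a.1 • β) ^ 2 := rfl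

/-- The uniform law of large numbers, on a ball, for the quadratic-type terms. -/
lemma tendstoInMeasure_empirical_quad [Fact (1 ≤ p)] {X : ℕ → Ω → EuclideanSpace ℝ (Fin d)}
    {e : ℕ → Ω → ℝ} (hindep : iIndepFun (fun i ω => (X i ω, e i ω)) μ)
    (hident : ∀ i, IdentDistrib (fun ω => (X i ω, e i ω)) (fun ω => (X 0 ω, e 0 ω)) μ μ)
    (hX : MemLp (X 0) 2 μ) (he : MemLp (e 0) 2 μ) (β : EuclideanSpace ℝ (Fin d)) {ρ δ : ℝ}
    (hδ : 0 < δ) :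
    Tendsto (fun n : ℕ => μ {ω | ¬ ∀ ξ : EuclideanSpace ℝ (Fin d), ‖ξ‖ ≤ ρ →
      |(n : ℝ)⁻¹ * ∑ i ∈ Finset.range n,
        vecNorm p (e i ω • ξ - inner ℝ ξ (X i ω) • β) ^ 2 - popQuad μ p (X 0) (e 0) β ξ| < δ})
      atTop (𝓝 0) := by
  set B := Metric.closedBall (0 : EuclideanSpace ℝ (Fin d)) ρ
  let _ : MeasurableSpace C(B, ℝ) := borel _
  have : BorelSpace C(B, ℝ) := ⟨rfl⟩
  set Q : EuclideanSpace ℝ (Fin d) × ℝ → C(B, ℝ) := fun a => quadOnBall p β ρ a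
  have hQc : Continuous Q := (quadOnBall p β ρ).continuous
  have hQm : Measurable Q := hQc.measurable
  have hmeas : ∀ i, AEMeasurable (fun ω => (X i ω, e i ω)) μ := fun i =>
    (hident i).aemeasurable_fst
  have hQs : ∀ i, AEStronglyMeasurable (fun ω => Q (X i ω, e i ω)) μ := fun i =>
    hQc.comp_aestronglyMeasurable (hmeas i).aestronglyMeasurable
  have hint : Integrable (fun ω => Q (X 0 ω, e 0 ω)) μ := by
    obtain ⟨C, hC0, hC⟩ := exists_vecNorm_le d p
    refine ((memLp_grad_bound (β := β) hX he C).mul_const ρ).integrable_sq.mono' (hQs 0)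
      (ae_of_all _ fun ω => ?_)
    refine (ContinuousMap.norm_le _ (by positivity)).2 fun ξ => ?_
    rw [quadOnBall_apply, Real.norm_of_nonneg (by positivity)]
    refine pow_le_pow_left₀ (vecNorm_nonneg _) ((vecNorm_grad_le hC _ _ _ _ hC0).trans ?_) 2
    gcongr
    exact mem_closedBall_zero_iff.1 ξ.2
  -- The strong law in the Banach space `C(B, ℝ)`: convergence in the supremum norm is the required
  -- uniformity.
  have hlln := strong_law_ae (fun i ω => Q (X i ω, e i ω)) hint
    (fun i j hij => (hindep.indepFun hij).comp hQm hQm) (fun i => (hident i).comp hQm)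
  have hmeasure := tendstoInMeasure_of_tendsto_ae (fun n => by
    exact (Finset.aestronglyMeasurable_fun_sum _ fun i _ => hQs i).const_smul ((n : ℝ)⁻¹)) hlln
  have h := hmeasure (ENNReal.ofReal δ) (by simpa using hδ)
  refine tendsto_of_tendsto_of_tendsto_of_le_of_le tendsto_const_nhds h (fun n => zero_le)
    fun n => measure_mono fun ω hω => ?_
  by_contra hlt
  refine hω fun ξ hξ => ?_
  simp only [Set.mem_ofPred_eq, not_le] at hlt
  rw [edist_lt_ofReal, ContinuousMap.dist_lt_iff hδ] at hlt
  have h1 := hlt ⟨ξ, by simpa [B] using hξ⟩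
  rw [ContinuousMap.integral_apply hint, Real.dist_eq] at h1
  simp only [ContinuousMap.smul_apply, ContinuousMap.sum_apply, smul_eq_mul] at h1
  exact h1

end LargeNumbers

/-! ### Deterministic comparison of the profile function with its limit functional. -/

lemma linErr_nonneg [Fact (1 ≤ p)] (β ξ : EuclideanSpace ℝ (Fin d)) (n : ℕ) :
    0 ≤ linErr p β n ξ :=
  mul_nonneg (by positivity) (mul_nonneg (vecNorm_nonneg _) (vecNorm_nonneg _))

lemma eventually_linErr_le [Fact (1 ≤ p)] (β : EuclideanSpace ℝ (Fin d)) {ρ δ : ℝ}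
    (hδ : 0 < δ) : ∀ᶠ n : ℕ in atTop, ∀ ξ : EuclideanSpace ℝ (Fin d), ‖ξ‖ ≤ ρ →
      linErr p β n ξ ≤ δ := by
  obtain ⟨C, hC0, hC⟩ := exists_vecNorm_le d p
  have h : Tendsto (fun n : ℕ => 2 * (vecNorm p β * (C * ρ)) / √(n : ℝ)) atTop (𝓝 0) :=
    (Real.tendsto_sqrt_atTop.comp tendsto_natCast_atTop_atTop).const_div_atTop _
  filter_upwards [h.eventually (gt_mem_nhds hδ)] with n hn ξ hξ
  refine le_trans ?_ hn.le
  rw [linErr, mul_div_right_comm]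
  have h1 : vecNorm p ξ ≤ C * ρ := (hC ξ).trans (by gcongr)
  have h2 := vecNorm_nonneg (p := p) β
  gcongr

/-- The scaled profile function is close to the transform of the normalized score as soon as the
empirical quadratic term is close to its population version. -/
lemma exists_abs_mul_profile_sub_le (hpq : ENNReal.HolderConjugate p q)
    {G : EuclideanSpace ℝ (Fin d) → ℝ} {c : ℝ} (hG : Continuous G) (hG0 : G 0 = 0) (hc : 0 < c)
    (hcG : ∀ ξ, c * ‖ξ‖ ^ 2 ≤ G ξ) (β : EuclideanSpace ℝ (Fin d)) {B η : ℝ} (hB : 0 ≤ B)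
    (hη : 0 < η) : ∃ ρ δ : ℝ, 0 < δ ∧ ∀ᶠ n : ℕ in atTop,
      ∀ w : ℕ → EuclideanSpace ℝ (Fin d) × ℝ, ‖scoreSum β n w‖ ≤ B →
      (∀ ξ : EuclideanSpace ℝ (Fin d), ‖ξ‖ ≤ ρ → |empQuad p β n w ξ - G ξ| < δ) →
      |n * (profile q n w β).toReal - quadConj G (scoreSum β n w)| ≤ η := by
  have := fact_one_le_of_holderConjugate hpq
  -- The radius exceeds the bound `2B/c` on the maximizer and makes `2ρB - cρ² + η` negative.
  set ρ := (2 * B + η + 1) / c + 1 with hρ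
  have hρ1 : 1 ≤ ρ := by
    rw [hρ]; have : 0 ≤ (2 * B + η + 1) / c := by positivity
    linarith
  have hcρ : c * ρ = 2 * B + η + 1 + c := by rw [hρ]; field_simp
  obtain ⟨M, hM⟩ := (isCompact_closedBall (0 : EuclideanSpace ℝ (Fin d)) ρ).bddAbove_image
    hG.continuousOn
  have hM' : ∀ ξ : EuclideanSpace ℝ (Fin d), ‖ξ‖ ≤ ρ → G ξ ≤ M := fun ξ hξ =>
    hM ⟨ξ, by simpa using hξ, rfl⟩
  have hM0 : 0 ≤ M := by simpa [hG0] using hM' 0 (by simpa using by linarith)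
  -- The bound `1/2` gives `1/(1 - k) ≤ 1 + 2k` for the linearization error `k`; the other bound
  -- absorbs the total error `2δ(M + 1) + δ` into `η`.
  set δ := min (1 / 2) (η / (2 * M + 3)) with hδ
  have hδ0 : 0 < δ := lt_min (by norm_num) (by positivity)
  have hδ1 : δ ≤ 1 / 2 := min_le_left _ _
  have hδη : δ * (2 * M + 3) ≤ η := (le_div_iff₀ (by positivity)).1 (min_le_right _ _)
  refine ⟨ρ, δ, hδ0, ?_⟩
  filter_upwards [eventually_linErr_le β hδ0 (p := p) (ρ := ρ), eventually_ge_atTop 1]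
    with n hlin hn w hH hQ
  set h := scoreSum β n w with hh
  have hQ0 : ∀ ξ, 0 ≤ empQuad p β n w ξ := fun ξ =>
    mul_nonneg (by positivity) (Finset.sum_nonneg fun i _ => by positivity)
  have hg0 := quadConj_nonneg hG hG0 hc hcG h
  refine abs_le.2 ⟨?_, ?_⟩
  · obtain ⟨ξ, hξ, hmax⟩ := exists_maximizer hG hG0 hc hcG h
    have hg : quadConj G h ≤ 2 * inner ℝ ξ h - G ξ := ciSup_le hmax
    have hξρ : ‖ξ‖ ≤ ρ := by
      refine hξ.trans ?_
      rw [div_le_iff₀ hc]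
      nlinarith
    have hk := hlin ξ hξρ
    have hk0 := linErr_nonneg (p := p) β ξ n
    have hle := le_mul_profile hpq hn w (β := β) (ξ := ξ) (by linarith)
    have hQξ := abs_lt.1 (hQ ξ hξρ)
    have hMξ := hM' ξ hξρ
    have hdiv : empQuad p β n w ξ / (1 - linErr p β n ξ) ≤ empQuad p β n w ξ + 2 * δ * (M + 1) := by
      rw [div_le_iff₀ (by linarith)]
      have h1 : empQuad p β n w ξ ≤ M + 1 := by linarith
      have h2 : linErr p β n ξ * empQuad p β n w ξ ≤ δ * (M + 1) :=
        mul_le_mul hk h1 (hQ0 ξ) hδ0.le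
      have h3 : δ * (M + 1) * (2 * linErr p β n ξ) ≤ δ * (M + 1) * 1 := by
        gcongr
        linarith
      nlinarith
    nlinarith
  · refine sub_le_iff_le_add.2 (le_of_forall_lt fun r hr => ?_)
    suffices H : ∀ r, 0 ≤ r → r < n * (profile q n w β).toReal → r ≤ quadConj G h + η by
      obtain ⟨s, hrs, hs⟩ := exists_between hr
      rcases le_or_gt 0 s with h0 | h0
      · have := H s h0 hs
        linarith
      · linarith
    intro r hr0 hr
    obtain ⟨ξ, s, hξ, hs, hor, hle⟩ := mul_profile_le hpq hn w β (by linarith : 0 < ρ) hr0 hr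
    have hk := hlin ξ hξ
    have hQξ := abs_lt.1 (hQ ξ hξ)
    have hMξ := hM' ξ hξ
    have h1 : linErr p β n ξ * empQuad p β n w ξ ≤ δ * (M + 1) :=
      mul_le_mul hk (by linarith) (hQ0 ξ) hδ0.le
    have h2 : s * r ≤ 2 * inner ℝ ξ h - G ξ + η := by nlinarith
    rcases hor with rfl | hor
    · have := le_quadConj hG hG0 hc hcG h ξ
      linarith
    -- On the sphere coercivity makes the dual value nonpositive, so `r ≤ 0`, which is below the
    -- nonnegative transform.
    · have h3 := hcG ξ
      have h4 : inner ℝ ξ h ≤ ρ * B := by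
        refine (real_inner_le_norm ξ h).trans ?_
        rw [hor]
        gcongr
      rw [hor] at h3
      have h5 : s * r ≤ 0 := by nlinarith
      have h6 : r ≤ 0 := by
        by_contra! hpos
        exact absurd h5 (not_le.2 (mul_pos hs hpos))
      linarith

lemma residual_eq {Ω : Type*} {X : ℕ → Ω → EuclideanSpace ℝ (Fin d)} {Y e : ℕ → Ω → ℝ}
    {β : EuclideanSpace ℝ (Fin d)} (hmodel : ∀ i ω, Y i ω = inner ℝ β (X i ω) + e i ω)
    (i : ℕ) (ω : Ω) : residual β (X i ω, Y i ω) = e i ω := by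
  simp [residual, hmodel]

/-! ### Convergence in distribution of the rescaled profile function. -/

section Probability

variable {Ω Ω' : Type*} [MeasurableSpace Ω] [MeasurableSpace Ω'] {μ : Measure Ω} {ν : Measure Ω'}

/-- Tightness of the single limit law passes to the sequence by the portmanteau theorem; the shift
to `B + 1` leaves room for a closed set. -/
lemma exists_eventually_measure_norm_gt_le [IsProbabilityMeasure μ] [IsProbabilityMeasure ν]
    {F : Type*} [NormedAddCommGroup F] [ProperSpace F]
    [MeasurableSpace F] [BorelSpace F] {H : ℕ → Ω → F} {W : Ω' → F}
    (h : TendstoInDistribution H atTop W (fun _ => μ) ν) {τ : ℝ≥0∞} (hτ : 0 < τ) :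
    ∃ B : ℝ, 0 ≤ B ∧ ∀ᶠ n in atTop, μ {ω | B < ‖H n ω‖} ≤ τ := by
  have hprob : IsProbabilityMeasure (ν.map W) :=
    Measure.isProbabilityMeasure_map h.aemeasurable_limit
  have htight := isTightMeasureSet_iff_tendsto_measure_norm_gt.1
    (isTightMeasureSet_singleton (μ := ν.map W))
  simp only [iSup_singleton] at htight
  obtain ⟨B, hB, hB0⟩ := ((htight.eventually (gt_mem_nhds hτ)).and (eventually_ge_atTop 0)).exists
  refine ⟨B + 1, by linarith, ?_⟩
  have hclosed : IsClosed {x : F | B + 1 ≤ ‖x‖} := isClosed_le continuous_const continuous_norm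
  have hlim := ProbabilityMeasure.limsup_measure_closed_le_of_tendsto h.tendsto hclosed
  simp only [ProbabilityMeasure.coe_mk] at hlim
  have hlt : limsup (fun n => (μ.map (H n)) {x : F | B + 1 ≤ ‖x‖}) atTop < τ := by
    refine hlim.trans_lt (lt_of_le_of_lt (measure_mono fun x hx => ?_) hB)
    simp only [Set.mem_ofPred_eq] at hx ⊢
    linarith
  filter_upwards [eventually_lt_of_limsup_lt hlt] with n hn
  refine le_trans ?_ hn.le
  rw [Measure.map_apply_of_aemeasurable (h.forall_aemeasurable n) hclosed.measurableSet]
  exact measure_mono fun ω (hω : B + 1 < ‖H n ω‖) => hω.le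

variable {X : ℕ → Ω → EuclideanSpace ℝ (Fin d)} {Y e : ℕ → Ω → ℝ}
  {β : EuclideanSpace ℝ (Fin d)} {σ : ℝ}

lemma aemeasurable_mul_profile (hpq : ENNReal.HolderConjugate p q)
    (hmodel : ∀ i ω, Y i ω = inner ℝ β (X i ω) + e i ω)
    (hident : ∀ i, IdentDistrib (fun ω => (X i ω, e i ω)) (fun ω => (X 0 ω, e 0 ω)) μ μ) (n : ℕ) :
    AEMeasurable (fun ω => (n : ℝ) * (profile q n (fun i => (X i ω, Y i ω)) β).toReal) μ := by
  rcases Nat.eq_zero_or_pos n with rfl | hn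
  · simp
  refine AEMeasurable.const_mul ((measurable_profile hpq hn β).comp_aemeasurable
    (f := fun ω i => (X i ω, Y i ω)) (aemeasurable_pi_lambda _ fun i => ?_)) _
  have h1 : AEMeasurable (X i) μ := measurable_fst.comp_aemeasurable (hident i).aemeasurable_fst
  have h2 : AEMeasurable (e i) μ := measurable_snd.comp_aemeasurable (hident i).aemeasurable_fst
  simp only [hmodel]
  fun_prop

lemma tendstoInDistribution_mul_profile [IsProbabilityMeasure μ] [IsProbabilityMeasure ν]
    (hpq : ENNReal.HolderConjugate p q)
    (hmodel : ∀ i ω, Y i ω = inner ℝ β (X i ω) + e i ω)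
    (hindep : iIndepFun (fun i ω => (X i ω, e i ω)) μ)
    (hident : ∀ i, IdentDistrib (fun ω => (X i ω, e i ω)) (fun ω => (X 0 ω, e 0 ω)) μ μ)
    (hXe : IndepFun (X 0) (e 0) μ) (hX : MemLp (X 0) 2 μ) (he : MemLp (e 0) 2 μ)
    (hmean : ∫ ω, e 0 ω ∂μ = 0) (hσ : σ ^ 2 = ∫ ω, e 0 ω ^ 2 ∂μ)
    (hpos : 0 < ∫ ω, e 0 ω ^ 2 ∂μ) {Z : Ω' → EuclideanSpace ℝ (Fin d)}
    (hZ : HasLaw Z (multivariateGaussian 0 (secondMoment μ (X 0))) ν) :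
    TendstoInDistribution
      (fun (n : ℕ) ω => (n : ℝ) * (profile q n (fun i => (X i ω, Y i ω)) β).toReal) atTop
      (fun ω' => limitValue μ p (X 0) (e 0) β σ (Z ω')) (fun _ => μ) ν := by
  have := fact_one_le_of_holderConjugate hpq
  obtain ⟨c, hc, hcG⟩ := exists_le_popQuad (p := p) (β := β) hXe hX he hmean hpos
  have hG := continuous_popQuad (p := p) (β := β) hX he
  have hG0 : popQuad μ p (X 0) (e 0) β 0 = 0 := popQuad_zero
  have hscore := tendstoInDistribution_score hindep hident hXe hX he hmean hσ hZ
  have hcomp := hscore.continuous_comp (continuous_quadConj hG hG0 hc hcG)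
  simp only [limitValue_eq_quadConj]
  -- Slutsky: the difference is small off two events, a large score and a failure of the uniform
  -- law, each eventually of probability at most `τ / 2`.
  refine tendstoInDistribution_of_tendstoInMeasure_sub _ _ hcomp ?_
    (aemeasurable_mul_profile hpq hmodel hident)
  have hsum : ∀ (n : ℕ) (ω : Ω), (√(n : ℝ))⁻¹ • ∑ k ∈ Finset.range n, e k ω • X k ω =
      scoreSum β n fun i => (X i ω, Y i ω) := fun n ω => by
    simp only [scoreSum, residual_eq hmodel]
  rw [tendstoInMeasure_iff_norm]
  intro ε hε
  rw [ENNReal.tendsto_nhds_zero]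
  intro τ hτ
  have hτ2 : 0 < τ / 2 := ENNReal.half_pos hτ.ne'
  obtain ⟨B, hB0, hB⟩ := exists_eventually_measure_norm_gt_le hscore hτ2
  obtain ⟨ρ, δ, hδ, hdet⟩ := exists_abs_mul_profile_sub_le hpq hG hG0 hc hcG β hB0 (half_pos hε)
  have hlln := ENNReal.tendsto_nhds_zero.1
    (tendstoInMeasure_empirical_quad (p := p) hindep hident hX he β (ρ := ρ) hδ) _ hτ2
  filter_upwards [hB, hdet, hlln] with n h1 h2 h3
  refine le_trans (measure_mono (t := {ω | B < ‖(√(n : ℝ))⁻¹ • ∑ k ∈ Finset.range n,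
    e k ω • X k ω‖} ∪ _) fun ω hω => ?_) ((measure_union_le _ _).trans
    ((add_le_add h1 h3).trans (ENNReal.add_halves τ).le))
  by_contra hnot
  rw [Set.mem_union, not_or] at hnot
  obtain ⟨hn1, hn2⟩ := hnot
  simp only [Set.mem_ofPred_eq, not_lt, not_not, hsum] at hn1 hn2
  have h4 := h2 _ hn1 fun ξ hξ => by
    have := hn2 ξ hξ
    simpa only [empQuad, gradVec, residual_eq hmodel] using this
  simp only [Set.mem_ofPred_eq, Pi.sub_apply, Function.comp_apply, Pi.zero_apply, sub_zero,
    Real.norm_eq_abs, hsum] at hω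
  linarith

lemma tendstoInDistribution_mul_profile_of_eq_zero [IsProbabilityMeasure μ] [IsProbabilityMeasure ν]
    (hpq : ENNReal.HolderConjugate p q)
    (hmodel : ∀ i ω, Y i ω = inner ℝ β (X i ω) + e i ω)
    (hident : ∀ i, IdentDistrib (fun ω => (X i ω, e i ω)) (fun ω => (X 0 ω, e 0 ω)) μ μ)
    (he0 : e 0 =ᵐ[μ] 0) {Z : Ω' → EuclideanSpace ℝ (Fin d)} :
    TendstoInDistribution
      (fun (n : ℕ) ω => (n : ℝ) * (profile q n (fun i => (X i ω, Y i ω)) β).toReal) atTop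
      (fun ω' => limitValue μ p (X 0) (e 0) β 0 (Z ω')) (fun _ => μ) ν := by
  have := fact_one_le_of_holderConjugate hpq
  have : Fact (1 ≤ q) := fact_one_le_of_holderConjugate (q := p) hpq.symm
  have hei : ∀ᵐ ω ∂μ, ∀ i, e i ω = 0 := by
    refine ae_all_iff.2 fun i => ?_
    exact ((hident i).comp measurable_snd).symm.ae_snd (p := fun t => t = 0)
      (measurableSet_singleton 0) he0
  have hzero : ∀ n : ℕ, (fun _ => (0 : ℝ)) =ᵐ[μ]
      fun ω => (n : ℝ) * (profile q n (fun i => (X i ω, Y i ω)) β).toReal := by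
    intro n
    filter_upwards [hei] with ω hω
    rcases Nat.eq_zero_or_pos n with rfl | hn
    · simp
    have h := profile_le_of_sum_estFun_eq_zero (q := q) hn (fun i => (X i ω, Y i ω)) β
      (fun i => X i ω) (Finset.sum_eq_zero fun i _ => by simp [estFun, hmodel, hω])
    simp only [sub_self, vecNorm_zero, ne_eq, OfNat.ofNat_ne_zero, not_false_eq_true, zero_pow,
      Finset.sum_const_zero, mul_zero, ENNReal.ofReal_zero, nonpos_iff_eq_zero] at h
    simp [h]
  have hlim : (fun _ => (0 : ℝ)) =ᵐ[ν] fun ω' => limitValue μ p (X 0) (e 0) β 0 (Z ω') :=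
    ae_of_all _ fun ω' => (limitValue_zero (Z ω')).symm
  refine TendstoInDistribution.congr hzero hlim ?_
  refine tendstoInDistribution_of_identDistrib 0 (fun _ => IdentDistrib.refl (by fun_prop))
    ⟨by fun_prop, by fun_prop, ?_⟩
  simp [Measure.map_const]

end Probability

end RWP

end

/-! ### The main theorem. -/

theorem mainTheorem6 {d : ℕ} {p q : ℝ≥0∞} (hpq : ENNReal.HolderConjugate p q)
    {Ω : Type*} [MeasurableSpace Ω] (μ : Measure Ω) [IsProbabilityMeasure μ]
    (X : ℕ → Ω → EuclideanSpace ℝ (Fin d)) (Y e : ℕ → Ω → ℝ)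
    (β : EuclideanSpace ℝ (Fin d)) (σ : ℝ)
    (hmodel : ∀ i ω, Y i ω = inner ℝ β (X i ω) + e i ω)
    (hindep : iIndepFun (fun i ω => (X i ω, e i ω)) μ)
    (hident : ∀ i, IdentDistrib (fun ω => (X i ω, e i ω)) (fun ω => (X 0 ω, e 0 ω)) μ μ)
    (hXe : IndepFun (X 0) (e 0) μ)
    (hX : MemLp (X 0) 2 μ) (he : MemLp (e 0) 2 μ)
    (hmean : ∫ ω, e 0 ω ∂μ = 0) (hσ : 0 ≤ σ) (hvar : Var[e 0; μ] = σ ^ 2)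
    {Ω' : Type*} [MeasurableSpace Ω'] (ν : Measure Ω') [IsProbabilityMeasure ν]
    (Z : Ω' → EuclideanSpace ℝ (Fin d))
    (hZ : HasLaw Z (multivariateGaussian 0 (RWP.secondMoment μ (X 0))) ν) :
    -- the profile function is finite, and the supremum defining the limit is a maximum
    (∀ n ω, 1 ≤ n → RWP.profile q n (fun i => (X i ω, Y i ω)) β ≠ ⊤) ∧
    (∀ z, IsGreatest (Set.range (RWP.limitObjective μ p (X 0) (e 0) β σ z))
      (RWP.limitValue μ p (X 0) (e 0) β σ z)) ∧
    -- convergence in distribution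
    TendstoInDistribution
      (fun (n : ℕ) ω => (n : ℝ) * (RWP.profile q n (fun i => (X i ω, Y i ω)) β).toReal) atTop
      (fun ω' => RWP.limitValue μ p (X 0) (e 0) β σ (Z ω')) (fun _ => μ) ν ∧
    -- the stochastic upper bound
    ((∫ ω, |e 0 ω| ∂μ) ^ 2 < ∫ ω, e 0 ω ^ 2 ∂μ →
      RWP.StochDominated (fun ω' => RWP.limitValue μ p (X 0) (e 0) β σ (Z ω')) ν
        (fun ω' => (∫ ω, e 0 ω ^ 2 ∂μ) / ((∫ ω, e 0 ω ^ 2 ∂μ) - (∫ ω, |e 0 ω| ∂μ) ^ 2) *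
          RWP.vecNorm q (Z ω') ^ 2) ν) ∧
    -- Gaussian errors
    (∀ v : ℝ≥0, HasLaw (e 0) (gaussianReal 0 v) μ →
      RWP.StochDominated (fun ω' => RWP.limitValue μ p (X 0) (e 0) β σ (Z ω')) ν
        (fun ω' => Real.pi / (Real.pi - 2) * RWP.vecNorm q (Z ω') ^ 2) ν) := by
  have := RWP.fact_one_le_of_holderConjugate hpq
  have : Fact (1 ≤ q) := RWP.fact_one_le_of_holderConjugate (q := p) hpq.symm
  have hσ2 : σ ^ 2 = ∫ ω, e 0 ω ^ 2 ∂μ := by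
    rw [← hvar, variance_of_integral_eq_zero he.1.aemeasurable hmean]
  refine ⟨fun n ω hn => RWP.profile_ne_top hn _ β, ?_, ?_, fun hlt =>
    RWP.stochDominated_of_le fun ω' => RWP.limitValue_le hpq hXe hX he hσ2 hlt hσ _,
    fun v hv => RWP.stochDominated_of_le fun ω' => ?_⟩
  · intro z
    rcases hσ.eq_or_lt with rfl | hpos
    · rw [RWP.limitValue_zero]
      exact RWP.isGreatest_limitObjective_zero z
    · obtain ⟨c, hc, hcG⟩ := RWP.exists_le_popQuad (p := p) (β := β) hXe hX he hmean
        (by rw [← hσ2]; positivity)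
      have h := RWP.isGreatest_quadConj (RWP.continuous_popQuad (p := p) (β := β) hX he)
        RWP.popQuad_zero hc hcG (σ • z)
      rw [← RWP.limitValue_eq_quadConj] at h
      convert! h using 2
      ext ξ
      rw [RWP.limitObjective_eq]
  · rcases hσ.eq_or_lt with rfl | hpos
    · refine RWP.tendstoInDistribution_mul_profile_of_eq_zero hpq hmodel hident ?_
      have h := (integral_eq_zero_iff_of_nonneg (fun ω => sq_nonneg (e 0 ω))
        he.integrable_sq).1 (by rw [← hσ2]; simp)
      filter_upwards [h] with ω hω
      simpa using hω
    · exact RWP.tendstoInDistribution_mul_profile hpq hmodel hindep hident hXe hX he hmean hσ2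
        (by rw [← hσ2]; positivity) hZ
  · have habs : (∫ ω, |e 0 ω| ∂μ) ^ 2 = 2 / Real.pi * v := by
      rw [← RWP.integral_abs_gaussianReal_sq v,
        ← hv.integral_comp (f := fun x => |x|) (by fun_prop)]
      rfl
    have hsq : ∫ ω, e 0 ω ^ 2 ∂μ = v := by
      rw [← hσ2, ← hvar, hv.variance_eq, variance_id_gaussianReal]
    have hpi : 2 < Real.pi := by linarith [Real.pi_gt_three]
    rcases eq_or_ne v 0 with rfl | hv0
    -- For a degenerate Gaussian the strict moment inequality fails, but the limit is `0` and the
    -- bound is nonnegative.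
    · have hσ0 : σ = 0 := by
        rw [hsq] at hσ2
        simpa using hσ2
      rw [hσ0, RWP.limitValue_zero]
      have : 0 < Real.pi - 2 := by linarith
      positivity
    · have hv' : (0 : ℝ) < v := by exact_mod_cast pos_iff_ne_zero.2 hv0
      have h := RWP.limitValue_le (p := p) (q := q) (β := β) hpq hXe hX he hσ2
        (by
          rw [habs, hsq]
          have : 2 / Real.pi < 1 := (div_lt_one Real.pi_pos).2 hpi
          nlinarith) hσ (Z ω')
      refine h.trans (le_of_eq ?_)
      rw [habs, hsq]
      have : Real.pi - 2 ≠ 0 := by linarith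
      congr 1
      field_simp
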